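/- For $Q\ge 1$ let $\mathfrak F_Q$ be the Farey sequence of order $Q$: the reduced fractions in $[0,1]$ with denominator at most $Q$, in increasing order. Let $r\ge 3$, $d\ge 2$ and $0\le c_1,\dots,c_r\le d-1$ be integers, and write $\mathbf c=(c_1,\dots,c_r)$. Let $N_Q^r(\mathbf c,d)$ be the number of $r$-tuples $(q_1,\dots,q_r)$ of denominators of $r$ consecutive fractions of $\mathfrak F_Q$ such that $q_j\equiv c_j \pmod d$ for $1\le j\le r$, and put $$\rho_Q^r(\mathbf c,d)=\frac{N_Q^r(\mathbf c,d)}{\#\mathfrak F_Q-(r-1)}.$$ Let $\mathcal T=\{(x,y)\in\mathbb R^2: x\le 1,\ y\le 1,\ x+y>1\}$ be the Farey triangle, with vertices $(1,0),(1,1),(0,1)$, and let $\mathcal T_Q=Q\mathcal T$. For $(x,y)\in\mathcal T$ put $L_{-1}=x$, $L_0=y$ and, for $j\ge 1$, $k_j(x,y)=\left[\frac{1+L_{j-2}}{L_{j-1}}\right]$ and $L_j=k_j(x,y)L_{j-1}-L_{j-2}$, where $[\cdot]$ is the integer part. For a vector $\mathbf k=(k_1,\dots,k_{r-2})$ of positive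 integers let $$\mathcal T[\mathbf k]=\{(x,y)\in\mathcal T: k_j(x,y)=k_j \text{ for } 1\le j\le r-2\}.$$ A pair of coprime integers $(q',q'')\in\mathcal T_Q$ generates the sequences $q_1=q'$, $q_2=q''$, $k_j=\left[\frac{q_j+Q}{q_{j+1}}\right]$, $q_{j+2}=k_jq_{j+1}-q_j$ ($j\ge 1$). Let $\mathcal K^{r-2}(\mathbf c,d)$ be the set of all vectors $(k_1,\dots,k_{r-2})$ of positive integers that are generated in this way by some coprime pair $(q',q'')\in\mathcal T_Q$, for some integer $Q\ge 1$, such that the generated $q_1,\dots,q_r$ satisfy $q_j\equiv c_j\pmod d$ for $1\le j\le r$. Then the series $\sum_{\mathbf k\in\mathcal K^{r-2}(\mathbf c,d)}\mathrm{Area}(\mathcal T[\mathbf k])$ converges, the limit $\rho^r(\mathbf c,d)=\lim_{Q\to\infty}\rho_Q^r(\mathbf c,d)$ exists, and $$\rho^r(\mathbf c,d)=\frac{2}{d^2}\prod_{p\mid d}\left(1-\frac1{p^2}\right)^{-1}\sum_{\mathbf k\in\mathcal K^{r-2}(\mathbf c,d)}\mathrm{Area}(\mathcal T[\mathbf k]),$$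 where the product is over the primes $p$ dividing $d$. -/

import Mathlib

open Filter Topology MeasureTheory
open scoped Pointwise

noncomputable section

/-- The Farey sequence of order `Q`, as a set: the rationals in `[0, 1]` whose reduced
denominator is at most `Q`. -/
def fareySet (Q : ℕ) : Set ℚ :=
  {x | 0 ≤ x ∧ x ≤ 1 ∧ x.den ≤ Q}

/-- `f` is an `r`-tuple of consecutive elements (in increasing order) of the Farey sequence
of order `Q`: it is increasing, and no element of the sequence between two of its entries is
left out. -/
def IsConsecutiveFarey (Q : ℕ) {r : ℕ} (f : Fin r → ℚ) : Prop :=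
  StrictMono f ∧ (∀ j, f j ∈ fareySet Q) ∧
    ∀ x ∈ fareySet Q, (∃ i, f i ≤ x) → (∃ j, x ≤ f j) → x ∈ Set.range f

/-- The set of `r`-tuples of denominators of consecutive fractions in the Farey sequence of
order `Q`. -/
def consecutiveDenominators (Q r : ℕ) : Set (Fin r → ℕ) :=
  {q | ∃ f : Fin r → ℚ, IsConsecutiveFarey Q f ∧ ∀ j, q j = (f j).den}

/-- The `r`-tuples of consecutive denominators that are congruent to `c` modulo `d`. -/
def denominatorsOfParity (Q : ℕ) {r : ℕ} (c : Fin r → ℕ) (d : ℕ) : Set (Fin r → ℕ) :=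
  {q | q ∈ consecutiveDenominators Q r ∧ ∀ j, q j ≡ c j [MOD d]}

theorem fareySet_finite (Q : ℕ) : (fareySet Q).Finite := by
  refine Set.Finite.subset
    ((((Set.finite_Icc (0 : ℤ) Q).prod (Set.finite_Icc (0 : ℕ) Q))).image
      fun p : ℤ × ℕ => (p.1 : ℚ) / p.2) ?_
  rintro x ⟨h0, h1, hQ⟩
  refine ⟨(x.num, x.den), ⟨⟨Rat.num_nonneg.2 h0, ?_⟩, Nat.zero_le _, hQ⟩, Rat.num_div_den x⟩
  have h2 : x.num ≤ (x.den : ℤ) := Rat.num_le_denom_iff.2 h1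
  have h3 : (x.den : ℤ) ≤ Q := by exact_mod_cast hQ
  exact h2.trans h3

theorem denominatorsOfParity_finite (Q : ℕ) {r : ℕ} (c : Fin r → ℕ) (d : ℕ) :
    (denominatorsOfParity Q c d).Finite := by
  refine Set.Finite.subset (Set.Finite.pi' fun _ : Fin r => Set.finite_Iic Q) ?_
  rintro q ⟨⟨f, hf, hq⟩, -⟩ j
  rw [hq j]
  exact (hf.2.1 j).2.2

/-- The proportion of `r`-tuples of consecutive Farey fractions of order `Q` whose tuple of
denominators is congruent to `c` modulo `d`. -/
def fareyProportion (Q : ℕ) {r : ℕ} (c : Fin r → ℕ) (d : ℕ) : ℝ :=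
  ((denominatorsOfParity Q c d).ncard : ℝ) / (((fareySet Q).ncard : ℝ) - ((r : ℝ) - 1))

/-- The Farey triangle with vertices `(1, 0)`, `(1, 1)`, `(0, 1)`. Its hypotenuse
`x + y = 1` is left out, since consecutive denominators satisfy `q' + q'' > Q`. -/
def fareyTriangle : Set (ℝ × ℝ) :=
  {p | p.1 ≤ 1 ∧ p.2 ≤ 1 ∧ 1 < p.1 + p.2}

/-- The coprime pairs of positive integers in the scaled triangle `Q • fareyTriangle`. -/
def IsGenerator (Q q' q'' : ℕ) : Prop :=
  ((q' : ℝ), (q'' : ℝ)) ∈ (Q : ℝ) • fareyTriangle ∧ Nat.Coprime q' q''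

/-- The sequence of denominators of order `Q` generated by `(q', q'')` (indexed from `0`):
`q_{j+2} = [(q_j + Q) / q_{j+1}] q_{j+1} - q_j`, with `[·]` the integer part. -/
def genDenom (Q q' q'' : ℕ) : ℕ → ℤ
  | 0 => q'
  | 1 => q''
  | j + 2 =>
    (genDenom Q q' q'' j + Q) / genDenom Q q' q'' (j + 1) * genDenom Q q' q'' (j + 1)
      - genDenom Q q' q'' j

/-- The sequence of integers `k_j = [(q_j + Q) / q_{j+1}]` of order `Q` generated by
`(q', q'')` (indexed from `0`). -/
def genIndex (Q q' q'' : ℕ) (j : ℕ) : ℤ :=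
  (genDenom Q q' q'' j + Q) / genDenom Q q' q'' (j + 1)

/-- The admissible vectors: the vectors of positive integers generated by some
coprime lattice point of some scaled triangle. -/
def admissible (s : ℕ) : Set (Fin s → ℕ) :=
  {k | (∀ i, 0 < k i) ∧
    ∃ Q q' q'' : ℕ, 1 ≤ Q ∧ IsGenerator Q q' q'' ∧ ∀ i : Fin s, genIndex Q q' q'' i = k i}

/-- The admissible vectors that correspond to `r`-tuples of consecutive denominators
congruent to `c` modulo `d`. -/
def admissibleOfParity {r : ℕ} (c : Fin r → ℕ) (d : ℕ) : Set (Fin (r - 2) → ℕ) :=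
  {k | k ∈ admissible (r - 2) ∧
    ∃ Q q' q'' : ℕ, 1 ≤ Q ∧ IsGenerator Q q' q'' ∧
      (∀ i : Fin (r - 2), genIndex Q q' q'' i = k i) ∧
      ∀ j : Fin r, genDenom Q q' q'' j ≡ c j [ZMOD d]}

/-- The sequence `L_{-1}(x, y) = x`, `L_0(x, y) = y`,
`L_j = [(1 + L_{j-2}) / L_{j-1}] L_{j-1} - L_{j-2}`, shifted so that it is indexed from `0`. -/
def fareyL (x y : ℝ) : ℕ → ℝ
  | 0 => x
  | 1 => y
  | j + 2 =>
    (⌊(1 + fareyL x y j) / fareyL x y (j + 1)⌋ : ℝ) * fareyL x y (j + 1) - fareyL x y j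

/-- The polygon of the points of the Farey triangle at which the vector
`([(1 + L_{j-2}) / L_{j-1}])_{1 ≤ j ≤ s}` equals `k`. -/
def fareyPolygon {s : ℕ} (k : Fin s → ℕ) : Set (ℝ × ℝ) :=
  {p | p ∈ fareyTriangle ∧
    ∀ i : Fin s, ⌊(1 + fareyL p.1 p.2 i) / fareyL p.1 p.2 (i + 1)⌋ = (k i : ℤ)}

/-- Area of a plane set: two-dimensional Lebesgue measure. -/
def area (S : Set (ℝ × ℝ)) : ℝ :=
  (volume S).toReal

end

/-! For consecutive Farey fractions with denominators `(q₁, q₂)` one has `q₁, q₂ ≤ Q < q₁ + q₂` and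
`gcd(q₁, q₂) = 1`, and each such pair occurs exactly once. The indices `k_j` produce all later
denominators, and they are the indices of the point `(q₁/Q, q₂/Q)` of the triangle. As the recursion
is integral and linear once the `k_j` are fixed, the residues of `q₁, …, q_r` depend only on those
of `q₁, q₂` and on `k`. So the tuple is congruent to `c` iff `(q₁, q₂) ≡ (c₁, c₂)` and `k` lies in
`admissibleOfParity c d` (`mem_generatingPoints_iff`).

Each polygon is convex, so its frontier is null, and it contains `κ_d / d² · Area · Q² + o(Q²)`
coprime points of one class when `gcd(c₁, c₂, d) = 1`; here `κ_d = ∑ μ(n)/n²` over `n` coprime to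
`d` (`tendsto_card_coprimePoints`). There are infinitely many polygons; they partition the triangle
and the total count has the right limit, so Scheffé's lemma allows summation over any subfamily.

The count of tuples differs from the count of pairs by at most `r`, and `#𝔉_Q ∼ (κ_1 / 2) Q²`. The
constant comes from `κ_1 = κ_d ∏_{p ∣ d} (1 - 1/p²)`. -/

/-! ### Equidistribution of lattice points in a residue class. -/

section Lattice

/-- The lattice points of `(0, Q]²` that are congruent to `(u, v)` modulo `m` and lie in the
dilate of `Ω` by `Q`. -/
noncomputable def residuePoints (Ω : Set (ℝ × ℝ)) (m u v Q : ℕ) : Finset (ℕ × ℕ) := by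
  classical
  exact {p ∈ Finset.Icc 1 Q ×ˢ Finset.Icc 1 Q |
    ((p.1 / Q : ℝ), (p.2 / Q : ℝ)) ∈ Ω ∧ p.1 ≡ u [MOD m] ∧ p.2 ≡ v [MOD m]}

theorem mem_residuePoints {Ω : Set (ℝ × ℝ)} {m u v Q : ℕ} {p : ℕ × ℕ} :
    p ∈ residuePoints Ω m u v Q ↔ ((1 ≤ p.1 ∧ p.1 ≤ Q) ∧ 1 ≤ p.2 ∧ p.2 ≤ Q) ∧
      ((p.1 / Q : ℝ), (p.2 / Q : ℝ)) ∈ Ω ∧ p.1 ≡ u [MOD m] ∧ p.2 ≡ v [MOD m] := by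
  classical
  simp [residuePoints]

/-- The intervals `[a, a + m)` with `a` in a fixed class tile the line; `m ≤ x` forces `a > x - m ≥
0`. -/
theorem exists_modEq_mem_Ico {m : ℕ} (hm : 0 < m) (e : ℕ) {x : ℝ} (hx : (m : ℝ) ≤ x) :
    ∃ a : ℕ, 1 ≤ a ∧ a ≡ e [MOD m] ∧ (a : ℝ) ≤ x ∧ x < a + m := by
  have hk : m ≤ ⌊x⌋₊ := Nat.le_floor hx
  have he : e % m < m := Nat.mod_lt _ hm
  have hr : (⌊x⌋₊ - e % m) % m < m := Nat.mod_lt _ hm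
  have hdiv := Nat.mod_add_div (⌊x⌋₊ - e % m) m
  set n := (⌊x⌋₊ - e % m) / m
  refine ⟨e % m + m * n, ?_, ?_, ?_, ?_⟩
  · omega
  · simp [Nat.ModEq]
  · have : e % m + m * n ≤ ⌊x⌋₊ := by omega
    exact (Nat.cast_le.2 this).trans (Nat.floor_le ((Nat.cast_nonneg m).trans hx))
  · have : ⌊x⌋₊ + 1 ≤ e % m + m * n + m := by omega
    have h2 : ((⌊x⌋₊ + 1 : ℕ) : ℝ) ≤ ((e % m + m * n + m : ℕ) : ℝ) := Nat.cast_le.2 this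
    have := Nat.lt_floor_add_one x
    push_cast at h2 ⊢
    linarith

theorem eq_of_modEq_of_mem_Ico {m e a b : ℕ} {x : ℝ} (ha : a ≡ e [MOD m]) (hb : b ≡ e [MOD m])
    (ha1 : (a : ℝ) ≤ x) (ha2 : x < a + m) (hb1 : (b : ℝ) ≤ x) (hb2 : x < b + m) : a = b := by
  have h1 : (a : ℝ) < b + m := by linarith
  have h2 : (b : ℝ) < a + m := by linarith
  norm_cast at h1 h2
  have hab := ha.trans hb.symm
  rcases le_total a b with h | h
  · obtain ⟨c, hc⟩ := (Nat.modEq_iff_dvd' h).1 hab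
    rcases Nat.eq_zero_or_pos c with rfl | hc0
    · omega
    · have := Nat.le_mul_of_pos_right m hc0
      omega
  · obtain ⟨c, hc⟩ := (Nat.modEq_iff_dvd' h).1 hab.symm
    rcases Nat.eq_zero_or_pos c with rfl | hc0
    · omega
    · have := Nat.le_mul_of_pos_right m hc0
      omega

/-- The square of side `m / Q` whose lower left corner is `p / Q`. -/
def gridBox (m Q : ℕ) (p : ℕ × ℕ) : Set (ℝ × ℝ) :=
  Set.Ico (p.1 / Q : ℝ) ((p.1 + m) / Q) ×ˢ Set.Ico (p.2 / Q : ℝ) ((p.2 + m) / Q)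

theorem mem_gridBox {m Q : ℕ} (hQ : 0 < Q) {p : ℕ × ℕ} {z : ℝ × ℝ} :
    z ∈ gridBox m Q p ↔ ((p.1 : ℝ) ≤ z.1 * Q ∧ z.1 * Q < p.1 + m) ∧
      (p.2 : ℝ) ≤ z.2 * Q ∧ z.2 * Q < p.2 + m := by
  have hQ' : (0 : ℝ) < Q := Nat.cast_pos.2 hQ
  simp only [gridBox, Set.mem_prod, Set.mem_Ico, div_le_iff₀ hQ', lt_div_iff₀ hQ']

theorem volume_gridBox (m Q : ℕ) (p : ℕ × ℕ) :
    volume (gridBox m Q p) = ENNReal.ofReal ((m / Q : ℝ) ^ 2) := by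
  have h : ∀ a : ℝ, (a + m) / Q - a / Q = m / Q := fun a => by ring
  rw [gridBox, Measure.volume_eq_prod, Measure.prod_prod, Real.volume_Ico, Real.volume_Ico, h, h,
    sq, ENNReal.ofReal_mul (by positivity)]

theorem measurableSet_gridBox (m Q : ℕ) (p : ℕ × ℕ) : MeasurableSet (gridBox m Q p) :=
  measurableSet_Ico.prod measurableSet_Ico

/-- Boxes based at points of one class mod `m` are disjoint, so counting points amounts to measuring
a union of boxes. -/
theorem volume_iUnion_gridBox (Ω : Set (ℝ × ℝ)) {m Q : ℕ} (u v : ℕ) (hQ : 0 < Q) :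
    (volume (⋃ p ∈ residuePoints Ω m u v Q, gridBox m Q p)).toReal =
      (residuePoints Ω m u v Q).card * (m / Q : ℝ) ^ 2 := by
  rw [measure_biUnion_finset _ fun p _ => measurableSet_gridBox m Q p]
  · simp only [volume_gridBox, Finset.sum_const, nsmul_eq_mul, ENNReal.toReal_mul,
      ENNReal.toReal_natCast]
    rw [ENNReal.toReal_ofReal (by positivity)]
  · intro p hp q hq hpq
    rw [Function.onFun, Set.disjoint_left]
    intro z hz hz'
    rw [mem_gridBox hQ] at hz hz'
    have hp' := (mem_residuePoints.1 hp).2.2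
    have hq' := (mem_residuePoints.1 hq).2.2
    exact hpq (Prod.ext
      (eq_of_modEq_of_mem_Ico hp'.1 hq'.1 hz.1.1 hz.1.2 hz'.1.1 hz'.1.2)
      (eq_of_modEq_of_mem_Ico hp'.2 hq'.2 hz.2.1 hz.2.2 hz'.2.1 hz'.2.2))

theorem dist_corner_le {m Q : ℕ} (hQ : 0 < Q) {p : ℕ × ℕ} {z : ℝ × ℝ} (hz : z ∈ gridBox m Q p) :
    dist ((p.1 / Q : ℝ), (p.2 / Q : ℝ)) z ≤ m / Q := by
  have hQ' : (0 : ℝ) < Q := Nat.cast_pos.2 hQ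
  obtain ⟨⟨h1, h2⟩, h3, h4⟩ := hz
  rw [add_div] at h2 h4
  rw [Prod.dist_eq, max_le_iff, Real.dist_eq, Real.dist_eq, abs_le, abs_le]
  dsimp only
  have : (0 : ℝ) ≤ m / Q := by positivity
  refine ⟨⟨?_, ?_⟩, ?_, ?_⟩ <;> linarith

/-- Lattice points in a fixed residue class are equidistributed. -/
theorem tendsto_card_residuePoints {Ω : Set (ℝ × ℝ)} (hΩ : Ω ⊆ Set.Ioc 0 1 ×ˢ Set.Ioc 0 1)
    (hfr : volume (frontier Ω) = 0) {m : ℕ} (hm : 0 < m) (u v : ℕ) :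
    Tendsto (fun Q : ℕ => ((residuePoints Ω m u v Q).card : ℝ) / (Q : ℝ) ^ 2) atTop
      (𝓝 (area Ω / (m : ℝ) ^ 2)) := by
  have hm' : (0 : ℝ) < m := Nat.cast_pos.2 hm
  have hmQ : Tendsto (fun Q : ℕ => (m : ℝ) / Q) atTop (𝓝 0) :=
    tendsto_const_div_atTop_nhds_zero_nat _
  have key : Tendsto (fun Q : ℕ => volume (⋃ p ∈ residuePoints Ω m u v Q, gridBox m Q p)) atTop
      (𝓝 (volume (interior Ω))) := by
    -- Off the null frontier, a point eventually lies in the union of boxes iff it lies in the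
    -- interior. All boxes stay in `B`, since `p/Q ≤ 1` and `m/Q ≤ m`.
    refine tendsto_measure_of_ae_tendsto_indicator atTop isOpen_interior.measurableSet
      (fun Q => Finset.measurableSet_biUnion _ fun p _ => measurableSet_gridBox m Q p)
      (B := Set.Icc 0 (1 + (m : ℝ)) ×ˢ Set.Icc 0 (1 + (m : ℝ))) (measurableSet_Icc.prod measurableSet_Icc)
      ?_ ?_ ?_
    · exact (isCompact_Icc.prod isCompact_Icc).measure_lt_top.ne
    · filter_upwards [eventually_gt_atTop 0] with Q hQ z hz
      have hQ' : (0 : ℝ) < Q := Nat.cast_pos.2 hQ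
      have hQ1 : (1 : ℝ) ≤ Q := Nat.one_le_cast.2 hQ
      simp only [Set.mem_iUnion] at hz
      obtain ⟨p, hp, ⟨h1, h2⟩, h3, h4⟩ := hz
      obtain ⟨⟨⟨-, g1⟩, ⟨-, g2⟩⟩, -⟩ := mem_residuePoints.1 hp
      have hb : ∀ a : ℕ, a ≤ Q → ((a : ℝ) + m) / Q ≤ 1 + m := fun a ha => by
        rw [div_le_iff₀ hQ']
        have : (a : ℝ) ≤ Q := Nat.cast_le.2 ha
        nlinarith
      exact ⟨⟨le_trans (by positivity) h1, h2.le.trans (hb _ g1)⟩,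
        ⟨le_trans (by positivity) h3, h4.le.trans (hb _ g2)⟩⟩
    · have hae : ∀ᵐ z : ℝ × ℝ, z ∉ frontier Ω := measure_eq_zero_iff_ae_notMem.1 hfr
      filter_upwards [hae] with z hz
      by_cases hzi : z ∈ interior Ω
      · obtain ⟨ε, hε, hball⟩ := Metric.isOpen_iff.1 isOpen_interior z hzi
        obtain ⟨⟨hz1, hz1'⟩, hz2, hz2'⟩ := hΩ (interior_subset hzi)
        have hlarge : ∀ t : ℝ, 0 < t → ∀ᶠ Q : ℕ in atTop, (m : ℝ) ≤ t * Q := fun t ht =>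
          (tendsto_natCast_atTop_atTop.const_mul_atTop ht).eventually_ge_atTop _
        filter_upwards [eventually_gt_atTop 0, hlarge _ hz1, hlarge _ hz2,
          hmQ.eventually_lt_const hε] with Q hQ hQ1 hQ2 hQε
        refine iff_of_true ?_ hzi
        have hQ' : (0 : ℝ) < Q := Nat.cast_pos.2 hQ
        obtain ⟨a, ha0, ha, ha1, ha2⟩ := exists_modEq_mem_Ico hm u hQ1
        obtain ⟨b, hb0, hb, hb1, hb2⟩ := exists_modEq_mem_Ico hm v hQ2
        have hbox : z ∈ gridBox m Q (a, b) := (mem_gridBox hQ).2 ⟨⟨ha1, ha2⟩, hb1, hb2⟩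
        have hle : ∀ {c : ℕ} {t : ℝ}, (c : ℝ) ≤ t * Q → t ≤ 1 → c ≤ Q := fun {c t} h h' => by
          have : (c : ℝ) ≤ Q := by nlinarith
          exact_mod_cast this
        simp only [Set.mem_iUnion]
        refine ⟨(a, b), mem_residuePoints.2
          ⟨⟨⟨ha0, hle ha1 hz1'⟩, hb0, hle hb1 hz2'⟩, ?_, ha, hb⟩, hbox⟩
        exact interior_subset (hball ((dist_corner_le hQ hbox).trans_lt hQε))
      · have hzc : z ∈ (closure Ω)ᶜ := fun h => hz ⟨h, hzi⟩
        obtain ⟨ε, hε, hball⟩ := Metric.isOpen_iff.1 isClosed_closure.isOpen_compl z hzc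
        filter_upwards [eventually_gt_atTop 0, hmQ.eventually_lt_const hε] with Q hQ hQε
        refine iff_of_false ?_ hzi
        simp only [Set.mem_iUnion, not_exists]
        intro p hp hbox
        exact hball ((dist_corner_le hQ hbox).trans_lt hQε)
          (subset_closure (mem_residuePoints.1 hp).2.1)
  have hint : volume (interior Ω) = volume Ω := by
    refine le_antisymm (measure_mono interior_subset) ?_
    calc volume Ω ≤ volume (interior Ω ∪ frontier Ω) :=
          measure_mono (subset_closure.trans (closure_eq_interior_union_frontier Ω).subset)
      _ ≤ volume (interior Ω) + volume (frontier Ω) := measure_union_le _ _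
      _ = volume (interior Ω) := by rw [hfr, add_zero]
  have hfin : volume Ω ≠ ⊤ :=
    ((measure_mono (hΩ.trans (Set.prod_mono Set.Ioc_subset_Icc_self Set.Ioc_subset_Icc_self))).trans_lt
      (isCompact_Icc.prod isCompact_Icc).measure_lt_top).ne
  rw [hint] at key
  have := ((ENNReal.tendsto_toReal hfin).comp key).div_const ((m : ℝ) ^ 2)
  refine this.congr' ?_
  filter_upwards [eventually_gt_atTop 0] with Q hQ
  have hQ' : (0 : ℝ) < Q := Nat.cast_pos.2 hQ
  rw [Function.comp_apply, volume_iUnion_gridBox Ω u v hQ]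
  field_simp

end Lattice

/-! ### Coprime lattice points and the constant `∑ μ(n)/n²`. -/

section Coprime

open scoped ArithmeticFunction.Moebius

/-- The points of `residuePoints` with coprime coordinates. -/
noncomputable def coprimePoints (Ω : Set (ℝ × ℝ)) (m u v Q : ℕ) : Finset (ℕ × ℕ) :=
  {p ∈ residuePoints Ω m u v Q | p.1.Coprime p.2}

/-- The sum of `μ(n) / n²` over the `n` coprime to `d`. -/
noncomputable def moebiusDensity (d : ℕ) : ℝ :=
  ∑' n : ℕ, if n.Coprime d then (μ n : ℝ) / (n : ℝ) ^ 2 else 0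

theorem sum_divisors_moebius (n : ℕ) : ∑ i ∈ n.divisors, μ i = if n = 1 then 1 else 0 := by
  rw [← ArithmeticFunction.coe_mul_zeta_apply, ArithmeticFunction.moebius_mul_coe_zeta,
    ArithmeticFunction.one_apply]

/-- Möbius inversion over the divisors of the gcd. The series is really finite: `μ 0 = 0`, and no `n
> Q` divides a coordinate in `[1, Q]`. -/
theorem card_filter_coprime (S : Finset (ℕ × ℕ)) (Q : ℕ)
    (hS : S ⊆ Finset.Icc 1 Q ×ˢ Finset.Icc 1 Q) :
    ((S.filter fun p => p.1.Coprime p.2).card : ℝ) =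
      ∑' n : ℕ, (μ n : ℝ) * ((S.filter fun p => n ∣ p.1 ∧ n ∣ p.2).card : ℝ) := by
  rw [tsum_eq_sum (s := Finset.Icc 1 Q)]
  · have h1 : ∀ p ∈ S, (if p.1.Coprime p.2 then (1 : ℝ) else 0) =
        ∑ n ∈ Finset.Icc 1 Q, (μ n : ℝ) * (if n ∣ p.1 ∧ n ∣ p.2 then 1 else 0) := by
      intro p hp
      have hp' := Finset.mem_product.1 (hS hp)
      simp only [Finset.mem_Icc] at hp'
      have h2 : (p.1.gcd p.2).divisors = (Finset.Icc 1 Q).filter fun n => n ∣ p.1 ∧ n ∣ p.2 := by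
        ext n
        simp only [Nat.mem_divisors, Finset.mem_filter, Finset.mem_Icc, Nat.dvd_gcd_iff]
        constructor
        · rintro ⟨⟨ha, hb⟩, -⟩
          exact ⟨⟨Nat.pos_of_dvd_of_pos ha hp'.1.1, (Nat.le_of_dvd hp'.1.1 ha).trans hp'.1.2⟩,
            ha, hb⟩
        · rintro ⟨-, hab⟩
          exact ⟨hab, (Nat.gcd_pos_of_pos_left _ hp'.1.1).ne'⟩
      have h3 := sum_divisors_moebius (p.1.gcd p.2)
      rw [h2, Finset.sum_filter] at h3
      have h4 := congrArg (Int.cast : ℤ → ℝ) h3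
      push_cast at h4
      simp only [mul_ite, mul_one, mul_zero]
      rw [h4]
    rw [Finset.card_filter]
    push_cast
    rw [Finset.sum_congr rfl h1, Finset.sum_comm]
    refine Finset.sum_congr rfl fun n _ => ?_
    rw [Finset.card_filter, ← Finset.mul_sum]
    push_cast
    rfl
  · intro n hn
    rcases Nat.eq_zero_or_pos n with rfl | hn0
    · simp
    · rw [Finset.filter_eq_empty_iff.2, Finset.card_empty, Nat.cast_zero, mul_zero]
      rintro p hp ⟨ha, -⟩
      have hp' := Finset.mem_product.1 (hS hp)
      simp only [Finset.mem_Icc] at hp' hn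
      exact hn ⟨hn0, (Nat.le_of_dvd hp'.1.1 ha).trans hp'.1.2⟩

theorem card_filter_dvd_le (S : Finset (ℕ × ℕ)) (Q n : ℕ)
    (hS : S ⊆ Finset.Icc 1 Q ×ˢ Finset.Icc 1 Q) :
    ((S.filter fun p => n ∣ p.1 ∧ n ∣ p.2).card : ℝ) ≤ ((Q : ℝ) / n) ^ 2 := by
  have h1 : S.filter (fun p => n ∣ p.1 ∧ n ∣ p.2) ⊆
      (Finset.Ioc 0 Q).filter (n ∣ ·) ×ˢ (Finset.Ioc 0 Q).filter (n ∣ ·) := by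
    intro p hp
    obtain ⟨hp, ha, hb⟩ := Finset.mem_filter.1 hp
    have hp' := Finset.mem_product.1 (hS hp)
    simp only [Finset.mem_Icc] at hp'
    simp only [Finset.mem_product, Finset.mem_filter, Finset.mem_Ioc]
    exact ⟨⟨⟨hp'.1.1, hp'.1.2⟩, ha⟩, ⟨hp'.2.1, hp'.2.2⟩, hb⟩
  have h2 := Finset.card_le_card h1
  rw [Finset.card_product, Nat.Ioc_filter_dvd_card_eq_div, ← sq] at h2
  calc ((S.filter fun p => n ∣ p.1 ∧ n ∣ p.2).card : ℝ) ≤ ((Q / n : ℕ) : ℝ) ^ 2 := by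
        exact_mod_cast h2
    _ ≤ _ := by
        gcongr
        exact Nat.cast_div_le

/-- By the Chinese remainder theorem, divisibility by `n` and the class mod `d` merge into one class
mod `n * d`. -/
theorem filter_dvd_residuePoints (Ω : Set (ℝ × ℝ)) {d u v n : ℕ} (hn : n.Coprime d) (Q : ℕ) :
    (residuePoints Ω d u v Q).filter (fun p => n ∣ p.1 ∧ n ∣ p.2) =
      residuePoints Ω (n * d) (Nat.chineseRemainder hn 0 u) (Nat.chineseRemainder hn 0 v) Q := by
  have h : ∀ a e : ℕ, a ≡ Nat.chineseRemainder hn 0 e [MOD n * d] ↔ n ∣ a ∧ a ≡ e [MOD d] := by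
    intro a e
    have h1 := (Nat.chineseRemainder hn 0 e).2
    rw [← Nat.modEq_and_modEq_iff_modEq_mul hn, ← Nat.modEq_zero_iff_dvd]
    exact ⟨fun h => ⟨h.1.trans h1.1, h.2.trans h1.2⟩,
      fun h => ⟨h.1.trans h1.1.symm, h.2.trans h1.2.symm⟩⟩
  ext p
  rw [Finset.mem_filter, mem_residuePoints, mem_residuePoints, h, h]
  tauto

/-- A common factor of `n` and `d` would divide `u`, `v` and `d`. -/
theorem filter_dvd_residuePoints_eq_empty (Ω : Set (ℝ × ℝ)) {d u v n : ℕ}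
    (huv : (u.gcd v).Coprime d) (hn : ¬ n.Coprime d) (Q : ℕ) :
    (residuePoints Ω d u v Q).filter (fun p => n ∣ p.1 ∧ n ∣ p.2) = ∅ := by
  refine Finset.filter_eq_empty_iff.2 ?_
  rintro p hp ⟨ha, hb⟩
  obtain ⟨-, -, hu, hv⟩ := mem_residuePoints.1 hp
  have h : ∀ {a e : ℕ}, n ∣ a → a ≡ e [MOD d] → n.gcd d ∣ e := fun ha he =>
    ((he.of_dvd (Nat.gcd_dvd_right n d)).dvd_iff dvd_rfl).1 ((Nat.gcd_dvd_left n d).trans ha)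
  exact hn (Nat.eq_one_of_dvd_coprimes huv (Nat.dvd_gcd (h ha hu) (h hb hv))
    (Nat.gcd_dvd_right n d))

theorem summable_one_div_sq : Summable fun n : ℕ => 1 / (n : ℝ) ^ 2 :=
  Real.summable_one_div_nat_pow.2 one_lt_two

theorem abs_moebius_cast_le (n : ℕ) : |(μ n : ℝ)| ≤ 1 := by
  exact_mod_cast (ArithmeticFunction.abs_moebius_le_one (n := n))

/-- Coprime lattice points in a fixed residue class are equidistributed. -/
theorem tendsto_card_coprimePoints {Ω : Set (ℝ × ℝ)} (hΩ : Ω ⊆ Set.Ioc 0 1 ×ˢ Set.Ioc 0 1)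
    (hfr : volume (frontier Ω) = 0) {d : ℕ} (hd : 0 < d) {u v : ℕ} (huv : (u.gcd v).Coprime d) :
    Tendsto (fun Q : ℕ => ((coprimePoints Ω d u v Q).card : ℝ) / (Q : ℝ) ^ 2) atTop
      (𝓝 (moebiusDensity d / (d : ℝ) ^ 2 * area Ω)) := by
  have hS : ∀ Q, residuePoints Ω d u v Q ⊆ Finset.Icc 1 Q ×ˢ Finset.Icc 1 Q := fun Q p hp => by
    simpa using (mem_residuePoints.1 hp).1
  have key : Tendsto (fun Q : ℕ => ∑' n : ℕ, (μ n : ℝ) *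
      (((residuePoints Ω d u v Q).filter fun p => n ∣ p.1 ∧ n ∣ p.2).card : ℝ) / (Q : ℝ) ^ 2) atTop
      (𝓝 (∑' n : ℕ, (if n.Coprime d then (μ n : ℝ) / (n : ℝ) ^ 2 else 0) *
        (area Ω / (d : ℝ) ^ 2))) := by
    -- The limit is taken termwise in `n`; at most `(Q/n)²` points have both coordinates divisible
    -- by `n`, so `1/n²` dominates.
    refine tendsto_tsum_of_dominated_convergence summable_one_div_sq ?_ ?_
    · intro n
      split_ifs with hn
      · rcases Nat.eq_zero_or_pos n with rfl | hn0
        · simp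
        simp only [filter_dvd_residuePoints Ω hn, mul_div_assoc]
        have := (tendsto_card_residuePoints hΩ hfr (Nat.mul_pos hn0 hd)
          (Nat.chineseRemainder hn 0 u) (Nat.chineseRemainder hn 0 v)).const_mul (μ n : ℝ)
        convert this using 2
        push_cast
        ring
      · simp [filter_dvd_residuePoints_eq_empty Ω huv hn]
    · filter_upwards [eventually_gt_atTop 0] with Q hQ n
      have hQ' : (0 : ℝ) < Q := Nat.cast_pos.2 hQ
      rw [Real.norm_eq_abs, abs_div, abs_mul, Nat.abs_cast, abs_of_pos (pow_pos hQ' 2),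
        div_le_iff₀ (pow_pos hQ' 2)]
      calc _ ≤ 1 * ((Q : ℝ) / n) ^ 2 := mul_le_mul (abs_moebius_cast_le n)
            (card_filter_dvd_le _ Q n (hS Q)) (Nat.cast_nonneg _) zero_le_one
        _ = _ := by ring
  rw [tsum_mul_right] at key
  convert key using 2 with Q
  · rw [coprimePoints, card_filter_coprime _ Q (hS Q), tsum_div_const]
  · rw [moebiusDensity]
    ring

theorem summable_moebiusDensity (d : ℕ) :
    Summable fun n : ℕ => ‖if n.Coprime d then (μ n : ℝ) / (n : ℝ) ^ 2 else 0‖ := by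
  refine Summable.of_nonneg_of_le (fun _ => norm_nonneg _) (fun n => ?_) summable_one_div_sq
  split_ifs
  · rw [Real.norm_eq_abs, abs_div, abs_of_nonneg (sq_nonneg (n : ℝ))]
    gcongr
    exact abs_moebius_cast_le n
  · rw [norm_zero]
    positivity

/-- Euler product: at `p` only the exponents 0 and 1 can contribute, and the latter only if `p ∤ d`.
-/
theorem hasProd_moebiusDensity (d : ℕ) :
    HasProd (fun p : Nat.Primes => if (p : ℕ) ∣ d then (1 : ℝ) else 1 - 1 / (p : ℝ) ^ 2)
      (moebiusDensity d) := by
  have h := EulerProduct.eulerProduct_hasProd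
    (f := fun n : ℕ => if n.Coprime d then (μ n : ℝ) / (n : ℝ) ^ 2 else 0) (by simp)
    (by
      intro m n hmn
      simp only [Nat.coprime_mul_iff_left,
        ArithmeticFunction.isMultiplicative_moebius.map_mul_of_coprime hmn]
      by_cases h1 : m.Coprime d
      · by_cases h2 : n.Coprime d
        · rw [if_pos ⟨h1, h2⟩, if_pos h1, if_pos h2]
          push_cast
          rw [mul_pow, mul_div_mul_comm]
        · rw [if_neg fun h => h2 h.2, if_neg h2, mul_zero]
      · rw [if_neg fun h => h1 h.1, if_neg h1, zero_mul])
    (summable_moebiusDensity d) (by simp)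
  refine (congrArg (fun f => HasProd f (moebiusDensity d)) (funext fun p => ?_)).mpr h
  have hp := p.2
  rw [tsum_eq_sum (s := Finset.range 2)]
  · rw [Finset.sum_range_succ, Finset.sum_range_one]
    simp only [pow_zero, pow_one, hp.coprime_iff_not_dvd, ArithmeticFunction.moebius_apply_prime hp]
    by_cases h : (p : ℕ) ∣ d
    · simp [h]
    · simp [h]
      ring
  · intro e he
    have he' : 1 < e := by simpa using he
    rw [ArithmeticFunction.moebius_apply_prime_pow hp (by omega), if_neg (by omega : e ≠ 1)]
    simp

theorem moebiusDensity_one_eq {d : ℕ} (hd : d ≠ 0) :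
    moebiusDensity 1 = moebiusDensity d * ∏ p ∈ d.primeFactors, (1 - 1 / (p : ℝ) ^ 2) := by
  have h1 := hasProd_moebiusDensity 1
  have h2 : HasProd (fun p : Nat.Primes => if (p : ℕ) ∣ d then 1 - 1 / (p : ℝ) ^ 2 else 1)
      (∏ p ∈ d.primeFactors, (1 - 1 / (p : ℝ) ^ 2)) := by
    have := hasProd_prod_of_ne_finset_one
      (f := fun p : Nat.Primes => if (p : ℕ) ∣ d then 1 - 1 / (p : ℝ) ^ 2 else 1)
      (s := d.primeFactors.subtype Nat.Prime) (L := SummationFilter.unconditional _) (by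
        intro p hp
        have : ¬ (p : ℕ) ∣ d := fun h => hp (Finset.mem_subtype.2 (Nat.mem_primeFactors.2 ⟨p.2, h, hd⟩))
        simp [this])
    convert this using 1
    rw [← Finset.prod_subtype_of_mem (fun p : ℕ => 1 - 1 / (p : ℝ) ^ 2)
      (fun p hp => (Nat.mem_primeFactors.1 hp).1)]
    refine Finset.prod_congr rfl fun p hp => ?_
    exact (if_pos (Nat.mem_primeFactors.1 (Finset.mem_subtype.1 hp)).2.1).symm
  have h3 := (hasProd_moebiusDensity d).mul h2
  refine h1.unique ?_
  convert h3 using 2 with p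
  have : ¬ (p : ℕ) ∣ 1 := fun h => p.2.one_lt.ne' (Nat.dvd_one.1 h)
  rw [if_neg this]
  split_ifs <;> ring

/-- The term `n = 1` is 1 and the others are at least `-1/n²`, so the sum is at least `2 - π²/6 >
0`. -/
theorem moebiusDensity_one_pos : 0 < moebiusDensity 1 := by
  have h1 : HasSum (fun n : ℕ => (if n = 1 then (2 : ℝ) else 0) - 1 / (n : ℝ) ^ 2)
      (2 - Real.pi ^ 2 / 6) := (hasSum_ite_eq 1 (2 : ℝ)).sub hasSum_zeta_two
  have h2 := h1.summable.tsum_le_tsum (fun n => ?_) (summable_moebiusDensity 1).of_norm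
  · rw [h1.tsum_eq] at h2
    have := Real.pi_lt_d2
    have := Real.pi_pos
    exact lt_of_lt_of_le (by nlinarith) h2
  · rw [if_pos (Nat.coprime_one_right n)]
    split_ifs with hn
    · subst hn
      norm_num
    · have h3 := (abs_le.1 (abs_moebius_cast_le n)).1
      calc _ = (-1) / (n : ℝ) ^ 2 := by ring
        _ ≤ _ := by gcongr

end Coprime

/-! ### Passing to the limit in sums over subfamilies. -/

section Scheffe

/-- Scheffé's lemma for series. -/
theorem tendsto_tsum_subtype_of_tendsto_tsum {ι : Type*} {u : ℕ → ι → ℝ} {v : ι → ℝ}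
    (hu : ∀ Q k, 0 ≤ u Q k) (hus : ∀ Q, Summable (u Q)) (hv : Summable v)
    (hlim : ∀ k, Tendsto (u · k) atTop (𝓝 (v k)))
    (hsum : Tendsto (fun Q => ∑' k, u Q k) atTop (𝓝 (∑' k, v k))) (S : Set ι) :
    Tendsto (fun Q => ∑' k : S, u Q k) atTop (𝓝 (∑' k : S, v k)) := by
  have hv0 : ∀ k, 0 ≤ v k := fun k => ge_of_tendsto' (hlim k) fun Q => hu Q k
  have hpos : ∀ Q, Summable fun k => max (v k - u Q k) 0 := fun Q =>
    Summable.of_nonneg_of_le (fun k => le_max_right _ _)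
      (fun k => max_le (by linarith [hu Q k]) (hv0 k)) hv
  -- Only the positive part of `v - u` is dominated by `v`; the absolute value follows from `|a| =
  -- 2a⁺ - a`, because the sums of `v - u` tend to 0.
  have h1 : Tendsto (fun Q => ∑' k, max (v k - u Q k) 0) atTop (𝓝 (∑' _ : ι, (0 : ℝ))) := by
    refine tendsto_tsum_of_dominated_convergence hv (fun k => ?_) (Eventually.of_forall fun Q k => ?_)
    · have := ((tendsto_const_nhds (x := v k)).sub (hlim k)).max (tendsto_const_nhds (x := (0 : ℝ)))
      simpa using this
    · rw [Real.norm_eq_abs, abs_of_nonneg (le_max_right _ _)]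
      exact max_le (by linarith [hu Q k]) (hv0 k)
  rw [tsum_zero] at h1
  have habs : ∀ a : ℝ, |a| = 2 * max a 0 - a := fun a => by
    rcases le_total 0 a with h | h
    · rw [abs_of_nonneg h, max_eq_left h]; ring
    · rw [abs_of_nonpos h, max_eq_right h]; ring
  have habss : ∀ Q, Summable fun k => |v k - u Q k| := fun Q => (hv.sub (hus Q)).abs
  have h2 : Tendsto (fun Q => ∑' k, |v k - u Q k|) atTop (𝓝 0) := by
    have h3 : ∀ Q, ∑' k, |v k - u Q k| =
        2 * ∑' k, max (v k - u Q k) 0 - (∑' k, v k - ∑' k, u Q k) := fun Q => by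
      rw [← hv.tsum_sub (hus Q), ← tsum_mul_left, ← ((hpos Q).mul_left 2).tsum_sub (hv.sub (hus Q))]
      exact tsum_congr fun k => habs _
    simp only [h3]
    simpa using (h1.const_mul 2).sub ((tendsto_const_nhds (x := ∑' k, v k)).sub hsum)
  rw [tendsto_iff_dist_tendsto_zero]
  refine squeeze_zero (fun _ => dist_nonneg) (fun Q => ?_) h2
  have h4 : ∑' k : S, v k - ∑' k : S, u Q k = ∑' k : S, (v k - u Q k) :=
    ((hv.subtype S).tsum_sub ((hus Q).subtype S)).symm
  rw [dist_comm, Real.dist_eq, h4]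
  refine (norm_tsum_le_tsum_norm (f := fun k : S => v k - u Q k) ((habss Q).subtype S)).trans ?_
  exact (habss Q).tsum_subtype_le _ S (fun _ => abs_nonneg _)

end Scheffe

/-! ### The Farey map and the polygons. -/

section Triangle

theorem mem_fareyTriangle {p : ℝ × ℝ} :
    p ∈ fareyTriangle ↔ p.1 ≤ 1 ∧ p.2 ≤ 1 ∧ 1 < p.1 + p.2 := Iff.rfl

theorem fareyTriangle_subset : fareyTriangle ⊆ Set.Ioc 0 1 ×ˢ Set.Ioc 0 1 := fun p hp => by
  obtain ⟨h1, h2, h3⟩ := hp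
  exact ⟨⟨by linarith, h1⟩, by linarith, h2⟩

theorem convex_fareyTriangle : Convex ℝ fareyTriangle := by
  rintro p ⟨h1, h2, h3⟩ q ⟨g1, g2, g3⟩ a b ha hb hab
  refine ⟨?_, ?_, ?_⟩ <;> simp only [Prod.fst_add, Prod.snd_add, Prod.smul_fst, Prod.smul_snd,
    smul_eq_mul]
  · nlinarith
  · nlinarith
  · rcases ha.eq_or_lt with rfl | ha'
    · have : b = 1 := by linarith
      subst this
      linarith
    · nlinarith

theorem floor_one_add_div_eq_iff {x y : ℝ} (hy : 0 < y) {k : ℤ} :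
    ⌊(1 + x) / y⌋ = k ↔ (k : ℝ) * y ≤ 1 + x ∧ 1 + x < (k + 1) * y := by
  rw [Int.floor_eq_iff, le_div_iff₀ hy, div_lt_iff₀ hy]

/-- The floor inequalities `k y ≤ 1 + x < (k + 1) y` say exactly that `k y - x ≤ 1 < y + (k y - x)`.
-/
theorem fareyL_mem_fareyTriangle {x y : ℝ} (h : (x, y) ∈ fareyTriangle) (j : ℕ) :
    (fareyL x y j, fareyL x y (j + 1)) ∈ fareyTriangle := by
  induction j with
  | zero => exact h
  | succ j ih =>
    obtain ⟨h1, h2, h3⟩ := ih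
    dsimp only at h1 h2 h3
    have hpos : 0 < fareyL x y (j + 1) := by linarith
    obtain ⟨h4, h5⟩ := (floor_one_add_div_eq_iff (x := fareyL x y j) hpos).1 rfl
    refine ⟨h2, ?_, ?_⟩
    · change (⌊(1 + fareyL x y j) / fareyL x y (j + 1)⌋ : ℝ) * fareyL x y (j + 1)
        - fareyL x y j ≤ 1
      linarith
    · change 1 < fareyL x y (j + 1) + ((⌊(1 + fareyL x y j) / fareyL x y (j + 1)⌋ : ℝ) *
        fareyL x y (j + 1) - fareyL x y j)
      linarith

theorem fareyL_pos {x y : ℝ} (h : (x, y) ∈ fareyTriangle) (j : ℕ) : 0 < fareyL x y j :=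
  (fareyTriangle_subset (fareyL_mem_fareyTriangle h j)).1.1

/-- The vector of the first `s` indices of a point of the plane. -/
noncomputable def fareyIndex (s : ℕ) (p : ℝ × ℝ) : Fin s → ℕ :=
  fun i => ⌊(1 + fareyL p.1 p.2 i) / fareyL p.1 p.2 (i + 1)⌋.toNat

theorem floor_fareyL_pos {p : ℝ × ℝ} (hp : p ∈ fareyTriangle) (j : ℕ) :
    0 < ⌊(1 + fareyL p.1 p.2 j) / fareyL p.1 p.2 (j + 1)⌋ := by
  have h := fareyL_mem_fareyTriangle (x := p.1) (y := p.2) hp j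
  have h1 := (fareyTriangle_subset h).1.1
  obtain ⟨⟨-, -⟩, h2, h3⟩ := fareyTriangle_subset h
  rw [Int.floor_pos, le_div_iff₀ h2]
  dsimp only at h1 h2 h3
  linarith

theorem mem_fareyPolygon_iff {s : ℕ} {k : Fin s → ℕ} {p : ℝ × ℝ} :
    p ∈ fareyPolygon k ↔ p ∈ fareyTriangle ∧ fareyIndex s p = k := by
  refine and_congr_right fun hp => ?_
  rw [funext_iff]
  refine forall_congr' fun i => ?_
  have := floor_fareyL_pos hp i
  simp only [fareyIndex]
  omega

theorem fareyPolygon_subset {s : ℕ} (k : Fin s → ℕ) : fareyPolygon k ⊆ fareyTriangle :=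
  fun _ hp => hp.1

/-- While the indices are fixed, each `L_j` is linear in the point, and the floor condition is a
pair of linear inequalities, hence preserved by convex combination. -/
theorem fareyL_convexCombination {p q : ℝ × ℝ} (hp : p ∈ fareyTriangle) (hq : q ∈ fareyTriangle)
    {a b : ℝ} (ha : 0 ≤ a) (hb : 0 ≤ b) (hab : a + b = 1) {k : ℕ → ℤ} {n : ℕ}
    (hpk : ∀ i < n, ⌊(1 + fareyL p.1 p.2 i) / fareyL p.1 p.2 (i + 1)⌋ = k i)
    (hqk : ∀ i < n, ⌊(1 + fareyL q.1 q.2 i) / fareyL q.1 q.2 (i + 1)⌋ = k i) :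
    (∀ i < n, ⌊(1 + fareyL (a • p + b • q).1 (a • p + b • q).2 i) /
      fareyL (a • p + b • q).1 (a • p + b • q).2 (i + 1)⌋ = k i) ∧
    fareyL (a • p + b • q).1 (a • p + b • q).2 n =
      a * fareyL p.1 p.2 n + b * fareyL q.1 q.2 n ∧
    fareyL (a • p + b • q).1 (a • p + b • q).2 (n + 1) =
      a * fareyL p.1 p.2 (n + 1) + b * fareyL q.1 q.2 (n + 1) := by
  induction n with
  | zero => exact ⟨fun i hi => absurd hi (Nat.not_lt_zero i), rfl, rfl⟩
  | succ n ih =>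
    obtain ⟨h1, h2, h3⟩ := ih (fun i hi => hpk i (by omega)) (fun i hi => hqk i (by omega))
    have hz : a • p + b • q ∈ fareyTriangle := convex_fareyTriangle hp hq ha hb hab
    have hp' := (floor_one_add_div_eq_iff (fareyL_pos (x := p.1) (y := p.2) hp (n + 1))).1
      (hpk n (by omega))
    have hq' := (floor_one_add_div_eq_iff (fareyL_pos (x := q.1) (y := q.2) hq (n + 1))).1
      (hqk n (by omega))
    have hn : ⌊(1 + fareyL (a • p + b • q).1 (a • p + b • q).2 n) /
        fareyL (a • p + b • q).1 (a • p + b • q).2 (n + 1)⌋ = k n := by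
      rw [floor_one_add_div_eq_iff (fareyL_pos (x := (a • p + b • q).1) (y := (a • p + b • q).2) hz
        (n + 1)), h2, h3]
      constructor
      · nlinarith [mul_le_mul_of_nonneg_left hp'.1 ha, mul_le_mul_of_nonneg_left hq'.1 hb]
      · rcases ha.eq_or_lt with rfl | ha'
        · have : b = 1 := by linarith
          subst this
          linarith [hq'.2]
        · nlinarith [mul_lt_mul_of_pos_left hp'.2 ha', mul_le_mul_of_nonneg_left hq'.2.le hb]
    refine ⟨fun i hi => ?_, h3, ?_⟩
    · rcases Nat.lt_succ_iff_lt_or_eq.1 hi with hi | rfl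
      · exact h1 i hi
      · exact hn
    · rw [fareyL, fareyL, fareyL, hn, hpk n (by omega), hqk n (by omega), h2, h3]
      ring

theorem convex_fareyPolygon {s : ℕ} (k : Fin s → ℕ) : Convex ℝ (fareyPolygon k) := by
  intro p hp q hq a b ha hb hab
  refine ⟨convex_fareyTriangle hp.1 hq.1 ha hb hab, fun i => ?_⟩
  -- The value 0 beyond `s` is never consulted.
  have h := fareyL_convexCombination hp.1 hq.1 ha hb hab
    (k := fun i => if h : i < s then k ⟨i, h⟩ else 0) (n := s)
    (fun i hi => by simpa [hi] using hp.2 ⟨i, hi⟩) (fun i hi => by simpa [hi] using hq.2 ⟨i, hi⟩)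
  simpa using h.1 i i.2

theorem area_fareyTriangle : area fareyTriangle = 1 / 2 := by
  have hmeas : MeasurableSet fareyTriangle :=
    (measurableSet_le measurable_fst measurable_const).inter
      ((measurableSet_le measurable_snd measurable_const).inter
        (measurableSet_lt measurable_const (measurable_fst.add measurable_snd)))
  have hsec : ∀ x : ℝ, volume (Prod.mk x ⁻¹' fareyTriangle) =
      (Set.Ioc 0 1).indicator (fun x => ENNReal.ofReal x) x := by
    intro x
    have h : Prod.mk x ⁻¹' fareyTriangle = if x ≤ 1 then Set.Ioc (1 - x) 1 else ∅ := by
      ext y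
      split_ifs with hx
      · simp only [Set.mem_preimage, mem_fareyTriangle, Set.mem_Ioc]
        constructor
        · rintro ⟨-, h, h'⟩
          exact ⟨by linarith, h⟩
        · rintro ⟨h, h'⟩
          exact ⟨hx, h', by linarith⟩
      · simp [mem_fareyTriangle, hx]
    rw [h]
    split_ifs with hx
    · rw [Real.volume_Ioc, sub_sub_cancel]
      by_cases h0 : 0 < x
      · rw [Set.indicator_of_mem (show x ∈ Set.Ioc 0 1 from ⟨h0, hx⟩)]
      · rw [Set.indicator_of_notMem fun h => h0 h.1, ENNReal.ofReal_of_nonpos (not_lt.1 h0)]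
    · rw [Set.indicator_of_notMem fun h => hx h.2, measure_empty]
  rw [area, Measure.volume_eq_prod, Measure.prod_apply hmeas]
  simp only [hsec]
  rw [lintegral_indicator measurableSet_Ioc, ← ofReal_integral_eq_lintegral_ofReal,
    ← intervalIntegral.integral_of_le zero_le_one, integral_id]
  · norm_num
  · exact (intervalIntegrable_iff_integrableOn_Ioc_of_le zero_le_one).1
      intervalIntegral.intervalIntegrable_id
  · exact (ae_restrict_iff' measurableSet_Ioc).2 (Eventually.of_forall fun x hx => hx.1.le)

theorem volume_fareyTriangle_ne_top : volume fareyTriangle ≠ ⊤ := fun h => by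
  have := area_fareyTriangle
  rw [area, h] at this
  norm_num at this

/-- The polygons partition the triangle; convexity supplies null-measurability. -/
theorem hasSum_area_fareyPolygon (s : ℕ) :
    HasSum (fun k : Fin s → ℕ => area (fareyPolygon k)) (1 / 2) := by
  have hU : ⋃ k : Fin s → ℕ, fareyPolygon k = fareyTriangle := by
    ext p
    simp [mem_fareyPolygon_iff]
  have hd : Pairwise (Function.onFun (AEDisjoint volume) fun k : Fin s → ℕ => fareyPolygon k) := by
    intro k l hkl
    refine Disjoint.aedisjoint (Set.disjoint_left.2 fun p hp hp' => hkl ?_)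
    rw [← (mem_fareyPolygon_iff.1 hp).2, (mem_fareyPolygon_iff.1 hp').2]
  have h := measure_iUnion₀ hd fun k => (convex_fareyPolygon k).nullMeasurableSet volume
  rw [hU] at h
  have hne : ∑' k : Fin s → ℕ, volume (fareyPolygon k) ≠ ⊤ := h ▸ volume_fareyTriangle_ne_top
  have hsum := (ENNReal.summable_toReal hne).hasSum
  rw [← ENNReal.tsum_toReal_eq fun k =>
    measure_ne_top_of_subset (fareyPolygon_subset k) volume_fareyTriangle_ne_top, ← h] at hsum
  rw [← area_fareyTriangle]
  exact hsum

end Triangle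

/-! ### Integer sequences generated by coprime pairs. -/

section Generators

theorem mem_fareyTriangle_div {Q a b : ℕ} (hQ : 0 < Q) :
    ((a / Q : ℝ), (b / Q : ℝ)) ∈ fareyTriangle ↔ a ≤ Q ∧ b ≤ Q ∧ Q < a + b := by
  have hQ' : (0 : ℝ) < Q := Nat.cast_pos.2 hQ
  rw [mem_fareyTriangle, div_le_one hQ', div_le_one hQ', ← add_div, one_lt_div hQ']
  norm_cast

theorem isGenerator_iff {Q a b : ℕ} (hQ : 0 < Q) :
    IsGenerator Q a b ↔ ((a / Q : ℝ), (b / Q : ℝ)) ∈ fareyTriangle ∧ a.Coprime b := by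
  have hQ' : (Q : ℝ) ≠ 0 := (Nat.cast_pos.2 hQ).ne'
  rw [IsGenerator, Set.mem_smul_set_iff_inv_smul_mem₀ hQ', Prod.smul_mk, smul_eq_mul, smul_eq_mul,
    inv_mul_eq_div, inv_mul_eq_div]

theorem floor_intCast_div_intCast (a : ℤ) {b : ℤ} (hb : 0 < b) : ⌊(a : ℝ) / b⌋ = a / b := by
  have hb' : (0 : ℝ) < b := Int.cast_pos.2 hb
  rw [Int.floor_eq_iff, le_div_iff₀ hb', div_lt_iff₀ hb']
  constructor
  · exact_mod_cast Int.ediv_mul_le a hb.ne'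
  · exact_mod_cast Int.lt_ediv_add_one_mul_self a hb

theorem genDenom_add_two (Q a b j : ℕ) :
    genDenom Q a b (j + 2) = genIndex Q a b j * genDenom Q a b (j + 1) - genDenom Q a b j := rfl

theorem genDenom_eq_fareyL {Q a b : ℕ} (hQ : 0 < Q)
    (h : ((a / Q : ℝ), (b / Q : ℝ)) ∈ fareyTriangle) (j : ℕ) :
    (genDenom Q a b j : ℝ) = Q * fareyL (a / Q) (b / Q) j ∧
    (genDenom Q a b (j + 1) : ℝ) = Q * fareyL (a / Q) (b / Q) (j + 1) ∧
    genIndex Q a b j =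
      ⌊(1 + fareyL (a / Q : ℝ) (b / Q) j) / fareyL (a / Q) (b / Q) (j + 1)⌋ := by
  have hQ' : (0 : ℝ) < Q := Nat.cast_pos.2 hQ
  have hidx : ∀ j, (genDenom Q a b j : ℝ) = Q * fareyL (a / Q) (b / Q) j →
      (genDenom Q a b (j + 1) : ℝ) = Q * fareyL (a / Q) (b / Q) (j + 1) → genIndex Q a b j =
      ⌊(1 + fareyL (a / Q : ℝ) (b / Q) j) / fareyL (a / Q) (b / Q) (j + 1)⌋ := by
    intro j h1 h2
    have h3 : 0 < genDenom Q a b (j + 1) := by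
      have := mul_pos hQ' (fareyL_pos h (j + 1))
      rw [← h2] at this
      exact_mod_cast this
    rw [genIndex, ← floor_intCast_div_intCast _ h3, h2]
    push_cast
    rw [h1]
    congr 1
    rw [← mul_div_mul_left (1 + fareyL (a / Q : ℝ) (b / Q) j) _ hQ'.ne']
    ring
  induction j with
  | zero =>
    have h1 : (genDenom Q a b 0 : ℝ) = Q * fareyL (a / Q) (b / Q) 0 := by
      simp only [genDenom, fareyL, Int.cast_natCast]
      field_simp
    have h2 : (genDenom Q a b 1 : ℝ) = Q * fareyL (a / Q) (b / Q) 1 := by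
      simp only [genDenom, fareyL, Int.cast_natCast]
      field_simp
    exact ⟨h1, h2, hidx 0 h1 h2⟩
  | succ j ih =>
    obtain ⟨h1, h2, h3⟩ := ih
    have h4 : (genDenom Q a b (j + 2) : ℝ) = Q * fareyL (a / Q) (b / Q) (j + 2) := by
      rw [genDenom_add_two, fareyL, h3]
      push_cast
      rw [h1, h2]
      ring
    exact ⟨h2, h4, hidx (j + 1) h2 h4⟩

theorem fareyIndex_eq_iff {Q a b s : ℕ} (hQ : 0 < Q)
    (h : ((a / Q : ℝ), (b / Q : ℝ)) ∈ fareyTriangle) {k : Fin s → ℕ} :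
    fareyIndex s ((a / Q : ℝ), (b / Q : ℝ)) = k ↔ ∀ i : Fin s, genIndex Q a b i = k i := by
  have h1 : ((a / Q : ℝ), (b / Q : ℝ)) ∈ fareyPolygon k ↔ _ := mem_fareyPolygon_iff
  rw [and_iff_right h] at h1
  rw [← h1]
  refine (and_iff_right h).trans (forall_congr' fun i => ?_)
  rw [(genDenom_eq_fareyL hQ h i).2.2]

/-- With equal indices both sequences obey the same linear recursion mod `d`, even for different
orders `Q` and `Q'`. -/
theorem genDenom_modEq {Q a b Q' a' b' s d : ℕ}
    (hk : ∀ i < s, genIndex Q a b i = genIndex Q' a' b' i)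
    (h0 : a ≡ a' [MOD d]) (h1 : b ≡ b' [MOD d]) {j : ℕ} (hj : j < s + 2) :
    genDenom Q a b j ≡ genDenom Q' a' b' j [ZMOD d] := by
  induction j using Nat.strong_induction_on with
  | _ j ih =>
    match j, hj, ih with
    | 0, _, _ => exact Int.natCast_modEq_iff.2 h0
    | 1, _, _ => exact Int.natCast_modEq_iff.2 h1
    | j + 2, hj, ih =>
      rw [genDenom_add_two, genDenom_add_two, hk j (by omega)]
      exact ((ih (j + 1) (by omega) (by omega)).mul_left _).sub (ih j (by omega) (by omega))

/-- The coprime points of the dilated triangle that generate a sequence with residues `c`. -/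
noncomputable def generatingPoints {r : ℕ} (c : Fin r → ℕ) (d Q : ℕ) : Finset (ℕ × ℕ) := by
  classical
  exact {p ∈ coprimePoints fareyTriangle 1 0 0 Q |
    ∀ j : Fin r, genDenom Q p.1 p.2 j ≡ c j [ZMOD d]}

theorem mem_coprimePoints_triangle {Q : ℕ} {p : ℕ × ℕ} :
    p ∈ coprimePoints fareyTriangle 1 0 0 Q ↔
      p.1.Coprime p.2 ∧ p.1 ≤ Q ∧ p.2 ≤ Q ∧ Q < p.1 + p.2 := by
  rw [coprimePoints, Finset.mem_filter, mem_residuePoints]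
  simp only [Nat.modEq_one, and_true]
  constructor
  · rintro ⟨⟨h, h'⟩, h''⟩
    exact ⟨h'', (mem_fareyTriangle_div (by omega)).1 h'⟩
  · rintro ⟨h, h'⟩
    exact ⟨⟨by omega, (mem_fareyTriangle_div (by omega)).2 h'⟩, h⟩

theorem mem_generatingPoints {r : ℕ} {c : Fin r → ℕ} {d Q : ℕ} {p : ℕ × ℕ} :
    p ∈ generatingPoints c d Q ↔ p ∈ coprimePoints fareyTriangle 1 0 0 Q ∧
      ∀ j : Fin r, genDenom Q p.1 p.2 j ≡ c j [ZMOD d] := by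
  classical
  simp [generatingPoints]

theorem tsum_card_filter_eq {α ι : Type*} (A : Finset α) (f : α → ι) (S : Set ι)
    [DecidableEq ι] [DecidablePred (· ∈ S)] :
    ∑' k : S, ((A.filter fun a => f a = k).card : ℝ) = (A.filter fun a => f a ∈ S).card := by
  rw [tsum_subtype S fun k => ((A.filter fun a => f a = k).card : ℝ),
    tsum_eq_sum (s := (A.filter fun a => f a ∈ S).image f)]
  · rw [Finset.card_eq_sum_card_image f]
    push_cast
    refine Finset.sum_congr rfl fun k hk => ?_
    obtain ⟨a, ha, rfl⟩ := Finset.mem_image.1 hk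
    rw [Set.indicator_of_mem (Finset.mem_filter.1 ha).2, Finset.filter_filter]
    congr 2
    ext b
    simp only [Finset.mem_filter]
    have := (Finset.mem_filter.1 ha).2
    constructor
    · rintro ⟨h, h'⟩
      exact ⟨h, h' ▸ this, h'⟩
    · rintro ⟨h, -, h'⟩
      exact ⟨h, h'⟩
  · intro k hk
    by_cases hkS : k ∈ S
    · rw [Set.indicator_of_mem hkS, Finset.filter_eq_empty_iff.2, Finset.card_empty, Nat.cast_zero]
      rintro a ha rfl
      exact hk (Finset.mem_image_of_mem f (Finset.mem_filter.2 ⟨ha, hkS⟩))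
    · exact Set.indicator_of_notMem hkS _

theorem summable_card_filter_eq {α ι : Type*} (A : Finset α) (f : α → ι) [DecidableEq ι] :
    Summable fun k => ((A.filter fun a => f a = k).card : ℝ) := by
  refine summable_of_ne_finset_zero (s := A.image f) fun k hk => ?_
  rw [Finset.filter_eq_empty_iff.2, Finset.card_empty, Nat.cast_zero]
  rintro a ha rfl
  exact hk (Finset.mem_image_of_mem f ha)

end Generators

/-! ### Counting the generating pairs. -/

section Limit

theorem coprimePoints_eq_filter {Ω Ω' : Set (ℝ × ℝ)} (h : Ω' ⊆ Ω) (d u v Q : ℕ)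
    [DecidablePred fun p : ℕ × ℕ => ((p.1 / Q : ℝ), (p.2 / Q : ℝ)) ∈ Ω'] :
    coprimePoints Ω' d u v Q =
      (coprimePoints Ω d u v Q).filter fun p => ((p.1 / Q : ℝ), (p.2 / Q : ℝ)) ∈ Ω' := by
  ext p
  simp only [coprimePoints, Finset.mem_filter, mem_residuePoints]
  have := @h ((p.1 / Q : ℝ), (p.2 / Q : ℝ))
  tauto

theorem coprimePoints_fareyPolygon {s : ℕ} (k : Fin s → ℕ) (d u v Q : ℕ) :
    coprimePoints (fareyPolygon k) d u v Q = (coprimePoints fareyTriangle d u v Q).filter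
      fun p => fareyIndex s ((p.1 / Q : ℝ), (p.2 / Q : ℝ)) = k := by
  classical
  rw [coprimePoints_eq_filter (fareyPolygon_subset k)]
  refine Finset.filter_congr fun p hp => ?_
  rw [mem_fareyPolygon_iff, and_iff_right]
  exact (mem_residuePoints.1 (Finset.mem_filter.1 hp).1).2.1

theorem mem_generatingPoints_iff {r : ℕ} (hr : 3 ≤ r) (c : Fin r → ℕ) {d Q : ℕ} (hQ : 0 < Q)
    (p : ℕ × ℕ) :
    p ∈ generatingPoints c d Q ↔
      p ∈ coprimePoints fareyTriangle d (c ⟨0, by omega⟩) (c ⟨1, by omega⟩) Q ∧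
      fareyIndex (r - 2) ((p.1 / Q : ℝ), (p.2 / Q : ℝ)) ∈ admissibleOfParity c d := by
  have hmod : p ∈ coprimePoints fareyTriangle d (c ⟨0, by omega⟩) (c ⟨1, by omega⟩) Q ↔
      p ∈ coprimePoints fareyTriangle 1 0 0 Q ∧ p.1 ≡ c ⟨0, by omega⟩ [MOD d] ∧
        p.2 ≡ c ⟨1, by omega⟩ [MOD d] := by
    simp only [coprimePoints, Finset.mem_filter, mem_residuePoints, Nat.modEq_one]
    tauto
  rw [hmod, mem_generatingPoints, and_assoc]
  refine and_congr_right fun hp => ?_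
  have hT : ((p.1 / Q : ℝ), (p.2 / Q : ℝ)) ∈ fareyTriangle :=
    (mem_residuePoints.1 (Finset.mem_filter.1 hp).1).2.1
  have hco : p.1.Coprime p.2 := (Finset.mem_filter.1 hp).2
  have hidx := (fareyIndex_eq_iff (s := r - 2) hQ hT).1 rfl
  have hgen := (isGenerator_iff hQ).2 ⟨hT, hco⟩
  constructor
  · intro h
    refine ⟨⟨Int.natCast_modEq_iff.1 (h ⟨0, by omega⟩),
      Int.natCast_modEq_iff.1 (h ⟨1, by omega⟩)⟩, ⟨?_, Q, p.1, p.2, hQ, hgen, hidx⟩,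
      Q, p.1, p.2, hQ, hgen, hidx, h⟩
    intro i
    have := floor_fareyL_pos hT i
    simp only [fareyIndex] at this ⊢
    omega
  -- The vector may be witnessed at another order `Q'` by another pair; that pair has the same first
  -- two residues and the same indices, so its residues transfer.
  · rintro ⟨⟨h0, h1⟩, -, Q', a, b, hQ', -, hk, hc⟩ j
    refine (genDenom_modEq (s := r - 2) (Q' := Q') (a' := a) (b' := b) (fun i hi => ?_) ?_ ?_
      (by omega)).trans (hc j)
    · rw [hidx ⟨i, hi⟩, hk ⟨i, hi⟩]
    · exact h0.trans (Int.natCast_modEq_iff.1 (hc ⟨0, by omega⟩)).symm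
    · exact h1.trans (Int.natCast_modEq_iff.1 (hc ⟨1, by omega⟩)).symm

theorem tendsto_card_coprimePoints_triangle {d : ℕ} (hd : 0 < d) {u v : ℕ}
    (huv : (u.gcd v).Coprime d) :
    Tendsto (fun Q : ℕ => ((coprimePoints fareyTriangle d u v Q).card : ℝ) / (Q : ℝ) ^ 2) atTop
      (𝓝 (moebiusDensity d / (d : ℝ) ^ 2 * (1 / 2))) := by
  have := tendsto_card_coprimePoints fareyTriangle_subset
    (convex_fareyTriangle.addHaar_frontier volume) hd huv
  rwa [area_fareyTriangle] at this

theorem tendsto_card_generatingPoints {r : ℕ} (hr : 3 ≤ r) (c : Fin r → ℕ) {d : ℕ} (hd : 0 < d)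
    (hc : ((c ⟨0, by omega⟩).gcd (c ⟨1, by omega⟩)).Coprime d) :
    Tendsto (fun Q : ℕ => ((generatingPoints c d Q).card : ℝ) / (Q : ℝ) ^ 2) atTop
      (𝓝 (moebiusDensity d / (d : ℝ) ^ 2 *
        ∑' k : admissibleOfParity c d, area (fareyPolygon k.1))) := by
  classical
  set u := c ⟨0, by omega⟩
  set v := c ⟨1, by omega⟩
  have hA := hasSum_area_fareyPolygon (r - 2)
  have key := tendsto_tsum_subtype_of_tendsto_tsum
    (u := fun Q (k : Fin (r - 2) → ℕ) =>
      ((coprimePoints (fareyPolygon k) d u v Q).card : ℝ) / (Q : ℝ) ^ 2)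
    (v := fun k => moebiusDensity d / (d : ℝ) ^ 2 * area (fareyPolygon k))
    (fun Q k => by positivity)
    (fun Q => by
      simp only [coprimePoints_fareyPolygon]
      exact (summable_card_filter_eq _ _).div_const _)
    (hA.summable.mul_left _)
    (fun k => tendsto_card_coprimePoints ((fareyPolygon_subset k).trans fareyTriangle_subset)
      ((convex_fareyPolygon k).addHaar_frontier volume) hd hc)
    -- Scheffé's hypothesis on totals: summed over all `k`, the counts give every coprime point of
    -- the class in the triangle.
    (by
      rw [tsum_mul_left, hA.tsum_eq]
      refine (tendsto_card_coprimePoints_triangle hd hc).congr fun Q => ?_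
      have h := tsum_card_filter_eq (coprimePoints fareyTriangle d u v Q)
        (fun p : ℕ × ℕ => fareyIndex (r - 2) ((p.1 / Q : ℝ), (p.2 / Q : ℝ))) Set.univ
      rw [tsum_univ fun k => (((coprimePoints fareyTriangle d u v Q).filter fun p =>
        fareyIndex (r - 2) ((p.1 / Q : ℝ), (p.2 / Q : ℝ)) = k).card : ℝ)] at h
      simp only [coprimePoints_fareyPolygon, tsum_div_const]
      rw [h]
      simp)
    (admissibleOfParity c d)
  rw [tsum_mul_left] at key
  refine key.congr' ?_
  filter_upwards [eventually_gt_atTop 0] with Q hQ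
  simp only [coprimePoints_fareyPolygon, tsum_div_const]
  rw [tsum_card_filter_eq]
  congr 3
  ext p
  rw [mem_generatingPoints_iff hr c hQ, Finset.mem_filter]

end Limit

/-! ### Consecutive Farey fractions and coprime pairs. -/

section Farey

/-- `y` is the element of the Farey sequence of order `Q` that follows `x`. -/
def IsFareySucc (Q : ℕ) (x y : ℚ) : Prop :=
  x ∈ fareySet Q ∧ y ∈ fareySet Q ∧ x < y ∧ ∀ z ∈ fareySet Q, x < z → y ≤ z

theorem IsFareySucc.unique {Q : ℕ} {x y z : ℚ} (h : IsFareySucc Q x y) (h' : IsFareySucc Q x z) :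
    y = z :=
  le_antisymm (h.2.2.2 z h'.2.1 h'.2.2.1) (h'.2.2.2 y h.2.1 h.2.2.1)

/-- The denominator of a fraction strictly between is a combination of `x.den` and `y.den` with
positive integer coefficients, hence exceeds `Q`. -/
theorem isFareySucc_of_det {Q : ℕ} {x y : ℚ} (hx : x ∈ fareySet Q) (hy : y ∈ fareySet Q)
    (hdet : y.num * x.den - x.num * y.den = 1) (hQ : Q < x.den + y.den) : IsFareySucc Q x y := by
  refine ⟨hx, hy, (Rat.lt_iff _ _).2 (by linarith), fun z hz hxz => ?_⟩
  by_contra! hzy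
  rw [Rat.lt_iff] at hxz hzy
  have hzQ : (z.den : ℤ) ≤ Q := by exact_mod_cast hz.2.2
  have hQ' : (Q : ℤ) < x.den + y.den := by exact_mod_cast hQ
  have hxd : (0 : ℤ) < x.den := by exact_mod_cast x.den_pos
  have hyd : (0 : ℤ) < y.den := by exact_mod_cast y.den_pos
  have h1 : (z.den : ℤ) = x.den * (y.num * z.den - z.num * y.den) +
      y.den * (z.num * x.den - x.num * z.den) := by
    linear_combination (-(z.den : ℤ)) * hdet
  nlinarith [mul_le_mul_of_nonneg_left (show 1 ≤ y.num * z.den - z.num * y.den by linarith) hxd.le,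
    mul_le_mul_of_nonneg_left (show 1 ≤ z.num * x.den - x.num * z.den by linarith) hyd.le]

theorem exists_rat_num_den {a b : ℤ} (hb : 0 < b) (hab : IsCoprime a b) :
    ∃ x : ℚ, x.num = a ∧ (x.den : ℤ) = b :=
  ⟨a / b, Rat.num_div_eq_of_coprime hb (Int.isCoprime_iff_nat_coprime.1 hab),
    Rat.den_div_eq_of_coprime hb (Int.isCoprime_iff_nat_coprime.1 hab)⟩

theorem mem_fareySet_of_det {Q : ℕ} {x y : ℚ} (hx0 : 0 ≤ x) (hx1 : x < 1)
    (hdet : y.num * x.den - x.num * y.den = 1) (hy : y.den ≤ Q) : y ∈ fareySet Q := by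
  have hxd : (0 : ℤ) < x.den := by exact_mod_cast x.den_pos
  have hyd : (0 : ℤ) < y.den := by exact_mod_cast y.den_pos
  have hxn : 0 ≤ x.num := Rat.num_nonneg.2 hx0
  have hxn' : x.num < x.den := Rat.num_lt_denom_iff.2 hx1
  refine ⟨Rat.num_nonneg.1 ?_, Rat.num_le_denom_iff.1 ?_, hy⟩
  · by_contra! h
    nlinarith [mul_nonneg hxn hyd.le]
  · by_contra! h
    nlinarith [mul_le_mul_of_nonneg_right (show x.num + 1 ≤ x.den from hxn') hyd.le]

theorem exists_isFareySucc {Q : ℕ} {x : ℚ} (hx : x ∈ fareySet Q) (hx1 : x < 1) :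
    ∃ y, IsFareySucc Q x y ∧ y.num * x.den - x.num * y.den = 1 ∧ Q < x.den + y.den := by
  have hxd : (0 : ℤ) < x.den := by exact_mod_cast x.den_pos
  obtain ⟨t, s, hst⟩ : IsCoprime x.num x.den := Int.isCoprime_iff_nat_coprime.2 x.reduced
  have h1 := Int.mul_ediv_self_le (x := (Q + t : ℤ)) hxd.ne'
  have h2 := Int.lt_mul_ediv_self_add (x := (Q + t : ℤ)) hxd
  -- Among the Bézout solutions, this `n` puts the denominator `x.den * n - t` in `(Q - x.den, Q]`.
  set n := (Q + t : ℤ) / x.den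
  have hxQ : (x.den : ℤ) ≤ Q := by exact_mod_cast hx.2.2
  have hdet : (s + x.num * n) * x.den - x.num * (x.den * n - t) = 1 := by linear_combination hst
  obtain ⟨y, hyn, hyd⟩ := exists_rat_num_den (a := s + x.num * n) (b := x.den * n - t)
    (by linarith) ⟨x.den, -x.num, by linear_combination hdet⟩
  rw [← hyn, ← hyd] at hdet
  have hlt : Q < x.den + y.den := by zify; linarith
  have hle : y.den ≤ Q := by zify; linarith
  exact ⟨y, isFareySucc_of_det hx (mem_fareySet_of_det hx.1 hx1 hdet hle) hdet hlt, hdet, hlt⟩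

theorem IsFareySucc.det {Q : ℕ} {x y : ℚ} (h : IsFareySucc Q x y) :
    y.num * x.den - x.num * y.den = 1 ∧ Q < x.den + y.den := by
  obtain ⟨z, hz, hdet⟩ := exists_isFareySucc h.1 (h.2.2.1.trans_le h.2.1.2.1)
  rwa [h.unique hz]

theorem IsFareySucc.coprime {Q : ℕ} {x y : ℚ} (h : IsFareySucc Q x y) :
    x.den.Coprime y.den := by
  rw [← Nat.isCoprime_iff_coprime]
  exact ⟨y.num, -x.num, by linear_combination h.det.1⟩

theorem exists_isFareySucc_of_coprime {Q a b : ℕ} (hab : a.Coprime b) (ha : a ≤ Q) (hb : b ≤ Q)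
    (hQ : Q < a + b) : ∃ x y, IsFareySucc Q x y ∧ x.den = a ∧ y.den = b := by
  have ha0 : (0 : ℤ) < a := by omega
  have hb0 : (0 : ℤ) < b := by omega
  obtain ⟨s, t, hst⟩ := Nat.isCoprime_iff_coprime.2 hab
  have h1 := Int.mul_ediv_self_le (x := -t) ha0.ne'
  have h2 := Int.lt_mul_ediv_self_add (x := -t) ha0
  -- This shift puts the numerator `-t - a * m` in `[0, a)`, so that `x` lies in `[0, 1)`.
  set m := -t / (a : ℤ)
  have hdet : (s - b * m) * a - (-t - a * m) * b = 1 := by linear_combination hst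
  obtain ⟨x, hxn, hxd⟩ := exists_rat_num_den (a := -t - a * m) ha0
    ⟨-b, s - b * m, by linear_combination hdet⟩
  obtain ⟨y, hyn, hyd⟩ := exists_rat_num_den (a := s - b * m) hb0
    ⟨a, -(-t - a * m), by linear_combination hdet⟩
  rw [← hxn, ← hyn, ← hxd, ← hyd] at hdet
  norm_cast at hxd hyd
  have hx0 : 0 ≤ x := Rat.num_nonneg.1 (by linarith)
  have hx1 : x < 1 := Rat.num_lt_denom_iff.1 (by rw [hxd]; linarith)
  exact ⟨x, y, isFareySucc_of_det ⟨hx0, hx1.le, hxd ▸ ha⟩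
    (mem_fareySet_of_det hx0 hx1 hdet (hyd ▸ hb)) hdet (by omega), hxd, hyd⟩

/-- The determinant relation fixes the numerator modulo `x.den`, and both numerators lie in `[0,
x.den)`. -/
theorem IsFareySucc.eq_of_den_eq {Q : ℕ} {x y x' y' : ℚ} (h : IsFareySucc Q x y)
    (h' : IsFareySucc Q x' y') (hx : x.den = x'.den) (hy : y.den = y'.den) : x = x' := by
  have h1 := h.det.1
  have h2 := h'.det.1
  rw [← hx, ← hy] at h2
  have hdvd : (x.den : ℤ) ∣ (x.num - x'.num) * y.den :=
    ⟨y.num - y'.num, by linear_combination h2 - h1⟩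
  have hdvd' := (Nat.isCoprime_iff_coprime.2 h.coprime).dvd_of_dvd_mul_right hdvd
  have hx0 := Rat.num_nonneg.2 h.1.1
  have hx1 := Rat.num_lt_denom_iff.2 (h.2.2.1.trans_le h.2.1.2.1)
  have hx0' := Rat.num_nonneg.2 h'.1.1
  have hx1' := Rat.num_lt_denom_iff.2 (h'.2.2.1.trans_le h'.2.1.2.1)
  rw [← hx] at hx1'
  have := Int.eq_zero_of_abs_lt_dvd hdvd' (abs_lt.2 ⟨by linarith, by linarith⟩)
  exact Rat.ext (by linarith) hx

/-- The two determinants give `x.den + z.den = k * y.den`. Then `x.den + Q = k * y.den + (Q -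
z.den)` is a Euclidean division, as `0 ≤ Q - z.den < y.den`. -/
theorem IsFareySucc.den_next {Q : ℕ} {x y z : ℚ} (h : IsFareySucc Q x y)
    (h' : IsFareySucc Q y z) :
    (z.den : ℤ) = (x.den + Q) / y.den * y.den - x.den := by
  obtain ⟨h1, -⟩ := h.det
  obtain ⟨h2, h3⟩ := h'.det
  have hyd : (0 : ℤ) < y.den := by exact_mod_cast y.den_pos
  have hzQ : (z.den : ℤ) ≤ Q := by exact_mod_cast h'.2.1.2.2
  have h3' : (Q : ℤ) < y.den + z.den := by exact_mod_cast h3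
  have hdvd : (y.den : ℤ) ∣ y.num * (z.den + x.den) :=
    ⟨z.num + x.num, by linear_combination h1 - h2⟩
  obtain ⟨k, hk⟩ := (show IsCoprime (y.den : ℤ) y.num from
    (Int.isCoprime_iff_nat_coprime.2 y.reduced).symm).dvd_of_dvd_mul_left hdvd
  have hq : ((x.den + Q : ℤ)) / y.den = k := ((Int.ediv_emod_unique (r := Q - z.den) hyd).2
    ⟨by linarith, by linarith, by linarith⟩).1
  rw [hq]
  linarith

theorem IsConsecutiveFarey.isFareySucc {Q r : ℕ} {f : Fin r → ℚ} (hf : IsConsecutiveFarey Q f)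
    {j : ℕ} (hj : j + 1 < r) : IsFareySucc Q (f ⟨j, by omega⟩) (f ⟨j + 1, hj⟩) := by
  refine ⟨hf.2.1 _, hf.2.1 _, hf.1 (Fin.mk_lt_mk.2 (Nat.lt_succ_self j)), fun z hz hjz => ?_⟩
  by_contra! hzj
  obtain ⟨i, rfl⟩ := hf.2.2 z hz ⟨_, hjz.le⟩ ⟨_, hzj.le⟩
  have h1 := Fin.lt_def.1 (hf.1.lt_iff_lt.1 hjz)
  have h2 := Fin.lt_def.1 (hf.1.lt_iff_lt.1 hzj)
  simp only at h1 h2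
  omega

theorem IsConsecutiveFarey.den_eq_genDenom {Q r : ℕ} {f : Fin r → ℚ}
    (hf : IsConsecutiveFarey Q f) (hr : 2 ≤ r) {j : ℕ} (hj : j < r) :
    ((f ⟨j, hj⟩).den : ℤ) =
      genDenom Q (f ⟨0, by omega⟩).den (f ⟨1, by omega⟩).den j := by
  induction j using Nat.strong_induction_on with
  | _ j ih =>
    match j, hj, ih with
    | 0, _, _ => rfl
    | 1, _, _ => rfl
    | j + 2, hj, ih =>
      rw [(hf.isFareySucc (j := j) (by omega)).den_next (hf.isFareySucc (j := j + 1) hj),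
        ih j (by omega), ih (j + 1) (by omega)]
      rfl

/-- The elements of the Farey sequence of order `Q` that are at least `x`. -/
noncomputable def fareyTail (Q : ℕ) (x : ℚ) : Finset ℚ :=
  {y ∈ (fareySet_finite Q).toFinset | x ≤ y}

theorem mem_fareyTail {Q : ℕ} {x y : ℚ} : y ∈ fareyTail Q x ↔ y ∈ fareySet Q ∧ x ≤ y := by
  simp [fareyTail]

theorem exists_isConsecutiveFarey {Q r : ℕ} {x : ℚ} (hx : x ∈ fareySet Q) (hr : 0 < r)
    (h : r ≤ (fareyTail Q x).card) :
    ∃ f : Fin r → ℚ, IsConsecutiveFarey Q f ∧ f ⟨0, hr⟩ = x := by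
  set g := (fareyTail Q x).orderEmbOfFin rfl
  have hg : ∀ i, g i ∈ fareySet Q ∧ x ≤ g i := fun i =>
    mem_fareyTail.1 (Finset.orderEmbOfFin_mem _ rfl i)
  have hrange : ∀ z ∈ fareySet Q, x ≤ z → ∃ i, g i = z := fun z hz hxz => by
    have : z ∈ Set.range g := by
      rw [Finset.range_orderEmbOfFin]
      exact mem_fareyTail.2 ⟨hz, hxz⟩
    exact this
  refine ⟨fun j => g (Fin.castLE h j), ⟨fun i j hij => g.strictMono (by simpa using hij),
    fun j => (hg _).1, ?_⟩, ?_⟩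
  · rintro z hz ⟨i, hi⟩ ⟨j, hj⟩
    obtain ⟨m, rfl⟩ := hrange z hz ((hg _).2.trans hi)
    have hm := Fin.le_def.1 (g.le_iff_le.1 hj)
    exact ⟨⟨m, lt_of_le_of_lt hm j.2⟩, rfl⟩
  · obtain ⟨m, hm⟩ := hrange x hx le_rfl
    exact le_antisymm ((g.monotone (Fin.le_def.2 (Nat.zero_le _))).trans_eq hm) (hg _).2

/-- The size of the tail strictly decreases along the sequence, so it determines the fraction. -/
theorem card_filter_fareyTail_lt (Q r : ℕ) :
    ((fareySet_finite Q).toFinset.filter fun x => (fareyTail Q x).card < r).card ≤ r := by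
  conv_rhs => rw [← Finset.card_range r]
  refine Finset.card_le_card_of_injOn (fun x => (fareyTail Q x).card)
    (fun x hx => by simpa using (Finset.mem_filter.1 hx).2) ?_
  have hlt : ∀ x ∈ fareySet Q, ∀ y, x < y → (fareyTail Q y).card < (fareyTail Q x).card := by
    intro x hx y hxy
    refine Finset.card_lt_card (Finset.ssubset_iff_of_subset (fun z hz => ?_) |>.2 ⟨x, ?_, ?_⟩)
    · have := mem_fareyTail.1 hz
      exact mem_fareyTail.2 ⟨this.1, hxy.le.trans this.2⟩
    · exact mem_fareyTail.2 ⟨hx, le_rfl⟩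
    · exact fun h => (mem_fareyTail.1 h).2.not_gt hxy
  intro x hx y hy hxy
  have hx' : x ∈ fareySet Q := by simpa using (Finset.mem_filter.1 hx).1
  have hy' : y ∈ fareySet Q := by simpa using (Finset.mem_filter.1 hy).1
  rcases lt_trichotomy x y with h | h | h
  · exact absurd hxy (hlt x hx' y h).ne'
  · exact h
  · exact absurd hxy (hlt y hy' x h).ne

/-- Every fraction but 1 has a successor, and the pair of denominators is a bijection onto the
coprime points; the 1 counts the last fraction. -/
theorem ncard_fareySet {Q : ℕ} (hQ : 0 < Q) :
    (fareySet Q).ncard = (coprimePoints fareyTriangle 1 0 0 Q).card + 1 := by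
  have h1 : (1 : ℚ) ∈ fareySet Q := ⟨zero_le_one, le_rfl, hQ⟩
  rw [← Set.ncard_sdiff_singleton_add_one h1 (fareySet_finite Q), ← Set.ncard_coe_finset]
  congr 1
  have hsucc : ∀ x ∈ fareySet Q \ {1}, ∃ y, IsFareySucc Q x y := fun x hx =>
    (exists_isFareySucc hx.1 (lt_of_le_of_ne hx.1.2.1 hx.2)).imp fun y hy => hy.1
  choose g hg using hsucc
  refine Set.ncard_congr (fun x hx => (x.den, (g x hx).den)) ?_ ?_ ?_
  · intro x hx
    have := hg x hx
    exact mem_coprimePoints_triangle.2 ⟨this.coprime, this.1.2.2, this.2.1.2.2, this.det.2⟩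
  · intro x x' hx hx' h
    exact (hg x hx).eq_of_den_eq (hg x' hx') (Prod.ext_iff.1 h).1 (Prod.ext_iff.1 h).2
  · intro p hp
    obtain ⟨h2, h3, h4, h5⟩ := mem_coprimePoints_triangle.1 hp
    obtain ⟨x, y, hxy, hx, hy⟩ := exists_isFareySucc_of_coprime h2 h3 h4 h5
    have hx1 : x ∈ fareySet Q \ {1} := ⟨hxy.1, (hxy.2.2.1.trans_le hxy.2.1.2.1).ne⟩
    refine ⟨x, hx1, Prod.ext hx ?_⟩
    rw [(hg x hx1).unique hxy]
    exact hy

theorem ncard_denominatorsOfParity_le {r : ℕ} (hr : 2 ≤ r) (c : Fin r → ℕ) (d Q : ℕ) :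
    (denominatorsOfParity Q c d).ncard ≤ (generatingPoints c d Q).card := by
  rw [← Set.ncard_coe_finset]
  refine Set.ncard_le_ncard_of_injOn (fun q => (q ⟨0, by omega⟩, q ⟨1, by omega⟩)) ?_ ?_
    (Finset.finite_toSet _)
  · rintro q ⟨⟨f, hf, hq⟩, hc⟩
    have hs := hf.isFareySucc (j := 0) (by omega)
    rw [Finset.mem_coe, mem_generatingPoints, mem_coprimePoints_triangle]
    simp only [hq] at hc ⊢
    refine ⟨⟨hs.coprime, hs.1.2.2, hs.2.1.2.2, hs.det.2⟩, fun j => ?_⟩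
    rw [← hf.den_eq_genDenom hr j.2]
    exact Int.natCast_modEq_iff.2 (hc j)
  · rintro q ⟨⟨f, hf, hq⟩, -⟩ q' ⟨⟨f', hf', hq'⟩, -⟩ h
    obtain ⟨h0, h1⟩ := Prod.ext_iff.1 h
    simp only [hq, hq'] at h0 h1
    funext j
    have h2 := hf.den_eq_genDenom hr j.2
    rw [h0, h1, ← hf'.den_eq_genDenom hr j.2] at h2
    rw [hq, hq']
    exact_mod_cast h2

/-- A pair fails to start an `r`-tuple only if fewer than `r` fractions remain from its first one
on. -/
theorem card_generatingPoints_le {r : ℕ} (hr : 2 ≤ r) (c : Fin r → ℕ) (d Q : ℕ) :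
    (generatingPoints c d Q).card ≤ (denominatorsOfParity Q c d).ncard + r := by
  classical
  have hex : ∀ p : generatingPoints c d Q, ∃ x y, IsFareySucc Q x y ∧ x.den = p.1.1 ∧
      y.den = p.1.2 := fun p => by
    obtain ⟨h2, h3, h4, h5⟩ := mem_coprimePoints_triangle.1 (mem_generatingPoints.1 p.2).1
    exact exists_isFareySucc_of_coprime h2 h3 h4 h5
  choose x y hxy hx hy using hex
  set D := (denominatorsOfParity_finite Q c d).toFinset
  set E := (fareySet_finite Q).toFinset.filter fun x => (fareyTail Q x).card < r
  have hD : (denominatorsOfParity Q c d).ncard = D.card := Set.ncard_eq_toFinset_card _ _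
  have hE : E.card ≤ r := card_filter_fareyTail_lt Q r
  have hsub : (generatingPoints c d Q) ⊆
      D.image (fun q => (q ⟨0, by omega⟩, q ⟨1, by omega⟩)) ∪
      ((generatingPoints c d Q).attach.filter fun p => x p ∈ E).image Subtype.val := by
    intro p hp
    set P : generatingPoints c d Q := ⟨p, hp⟩
    rw [Finset.mem_union]
    by_cases hcard : (fareyTail Q (x P)).card < r
    · right
      refine Finset.mem_image.2 ⟨P, Finset.mem_filter.2 ⟨Finset.mem_attach _ _, ?_⟩, rfl⟩
      exact Finset.mem_filter.2 ⟨(Set.Finite.mem_toFinset _).2 (hxy P).1, hcard⟩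
    · left
      obtain ⟨f, hf, hf0⟩ := exists_isConsecutiveFarey (hxy P).1 (by omega) (not_lt.1 hcard)
      have hf1 : f ⟨1, by omega⟩ = y P := by
        have := hf.isFareySucc (j := 0) (by omega)
        rw [hf0] at this
        exact this.unique (hxy P)
      have hp0 : (f ⟨0, by omega⟩).den = p.1 := by rw [hf0, hx]
      have hp1 : (f ⟨1, by omega⟩).den = p.2 := by rw [hf1, hy]
      refine Finset.mem_image.2 ⟨fun j => (f j).den, ?_, Prod.ext hp0 hp1⟩
      refine (Set.Finite.mem_toFinset _).2 ⟨⟨f, hf, fun _ => rfl⟩, fun j => ?_⟩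
      have := (mem_generatingPoints.1 hp).2 j
      rw [← hp0, ← hp1, ← hf.den_eq_genDenom hr j.2] at this
      exact Int.natCast_modEq_iff.1 this
  have hle : ((generatingPoints c d Q).attach.filter fun p => x p ∈ E).card ≤ E.card := by
    refine Finset.card_le_card_of_injOn x (fun p hp => (Finset.mem_filter.1 hp).2) ?_
    intro p _ q _ hpq
    have h := hxy q
    rw [← hpq] at h
    have hpy := (hxy p).unique h
    refine Subtype.ext (Prod.ext ?_ ?_)
    · rw [← hx, ← hx, hpq]
    · rw [← hy, ← hy, hpy]
  calc (generatingPoints c d Q).card ≤ _ := Finset.card_le_card hsub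
    _ ≤ _ := Finset.card_union_le _ _
    _ ≤ D.card + E.card := add_le_add Finset.card_image_le (Finset.card_image_le.trans hle)
    _ ≤ _ := by rw [hD]; omega

end Farey

/-! ### From counts to proportions. -/

section Proportion

theorem tendsto_const_div_sq (a : ℝ) : Tendsto (fun Q : ℕ => a / (Q : ℝ) ^ 2) atTop (𝓝 0) :=
  tendsto_const_nhds.div_atTop
    ((tendsto_pow_atTop two_ne_zero).comp tendsto_natCast_atTop_atTop)

theorem tendsto_ncard_fareySet :
    Tendsto (fun Q : ℕ => ((fareySet Q).ncard : ℝ) / (Q : ℝ) ^ 2) atTop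
      (𝓝 (moebiusDensity 1 / 2)) := by
  have h := (tendsto_card_coprimePoints_triangle (d := 1) one_pos (u := 0) (v := 0)
    (Nat.coprime_one_right _)).add (tendsto_const_div_sq 1)
  convert h.congr' ?_ using 2
  · norm_num
    ring
  · filter_upwards [eventually_gt_atTop 0] with Q hQ
    rw [ncard_fareySet hQ, ← add_div]
    push_cast
    rfl

theorem tendsto_ncard_denominatorsOfParity {r : ℕ} (hr : 2 ≤ r) (c : Fin r → ℕ) (d : ℕ) {A : ℝ}
    (h : Tendsto (fun Q : ℕ => ((generatingPoints c d Q).card : ℝ) / (Q : ℝ) ^ 2) atTop (𝓝 A)) :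
    Tendsto (fun Q : ℕ => ((denominatorsOfParity Q c d).ncard : ℝ) / (Q : ℝ) ^ 2) atTop (𝓝 A) := by
  have h' := h.sub (tendsto_const_div_sq r)
  rw [sub_zero] at h'
  refine tendsto_of_tendsto_of_tendsto_of_le_of_le h' h (fun Q => ?_) fun Q => ?_
  · have : ((generatingPoints c d Q).card : ℝ) ≤ (denominatorsOfParity Q c d).ncard + r := by
      exact_mod_cast card_generatingPoints_le hr c d Q
    dsimp only
    rw [← sub_div]
    gcongr
    linarith
  · dsimp only
    gcongr
    exact ncard_denominatorsOfParity_le hr c d Q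

theorem tendsto_fareyProportion {r : ℕ} (hr : 2 ≤ r) (c : Fin r → ℕ) (d : ℕ) {A : ℝ}
    (h : Tendsto (fun Q : ℕ => ((generatingPoints c d Q).card : ℝ) / (Q : ℝ) ^ 2) atTop (𝓝 A)) :
    Tendsto (fun Q : ℕ => fareyProportion Q c d) atTop (𝓝 (A / (moebiusDensity 1 / 2))) := by
  have hF := tendsto_ncard_fareySet.sub (tendsto_const_div_sq ((r : ℝ) - 1))
  rw [sub_zero] at hF
  refine ((tendsto_ncard_denominatorsOfParity hr c d h).div hF
    (half_pos moebiusDensity_one_pos).ne').congr' ?_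
  filter_upwards [eventually_gt_atTop 0] with Q hQ
  have hQ' : ((Q : ℝ) ^ 2) ≠ 0 := pow_ne_zero 2 (Nat.cast_pos.2 hQ).ne'
  rw [Pi.div_apply, ← sub_div, div_div_div_cancel_right₀ hQ', fareyProportion]

theorem coprime_gcd_of_modEq {a b d u v : ℕ} (hab : a.Coprime b)
    (hu : a ≡ u [MOD d]) (hv : b ≡ v [MOD d]) : (u.gcd v).Coprime d := by
  have h : ∀ {x e : ℕ}, x ≡ e [MOD d] → (u.gcd v).gcd d ∣ e → (u.gcd v).gcd d ∣ x := fun hx he =>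
    ((hx.of_dvd (Nat.gcd_dvd_right _ d)).dvd_iff dvd_rfl).2 he
  exact Nat.eq_one_of_dvd_coprimes hab
    (h hu ((Nat.gcd_dvd_left _ d).trans (Nat.gcd_dvd_left u v)))
    (h hv ((Nat.gcd_dvd_left _ d).trans (Nat.gcd_dvd_right u v)))

end Proportion

theorem corollary1 (r d : ℕ) (hr : 3 ≤ r) (hd : 2 ≤ d) (c : Fin r → ℕ)
    (hc : ∀ j, c j ≤ d - 1) :
    (Summable fun k : admissibleOfParity c d => area (fareyPolygon k.1)) ∧
    Tendsto (fun Q : ℕ => fareyProportion Q c d) atTop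
      (𝓝 (2 / (d : ℝ) ^ 2 * (∏ p ∈ d.primeFactors, (1 - 1 / (p : ℝ) ^ 2)⁻¹) *
        ∑' k : admissibleOfParity c d, area (fareyPolygon k.1))) := by
  refine ⟨(hasSum_area_fareyPolygon (r - 2)).summable.subtype _, ?_⟩
  -- If `gcd(c₁, c₂, d) > 1`, no coprime pair has these residues, so there are no admissible vectors
  -- and both sides vanish.
  by_cases huv : ((c ⟨0, by omega⟩).gcd (c ⟨1, by omega⟩)).Coprime d
  · have h := tendsto_fareyProportion (by omega) c d
      (tendsto_card_generatingPoints hr c (by omega) huv)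
    have hd' : (d : ℝ) ≠ 0 := by positivity
    have hκ := moebiusDensity_one_eq (d := d) (by omega)
    have hne := moebiusDensity_one_pos.ne'
    rw [hκ] at h hne
    convert h using 2
    have h1 := left_ne_zero_of_mul hne
    have h2 := right_ne_zero_of_mul hne
    rw [Finset.prod_inv_distrib]
    field_simp
  · have hgen : ∀ Q, generatingPoints c d Q = ∅ := fun Q => by
      refine Finset.eq_empty_of_forall_notMem fun p hp => huv ?_
      obtain ⟨hp, hpc⟩ := mem_generatingPoints.1 hp
      exact coprime_gcd_of_modEq (mem_coprimePoints_triangle.1 hp).1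
        (Int.natCast_modEq_iff.1 (hpc ⟨0, by omega⟩))
        (Int.natCast_modEq_iff.1 (hpc ⟨1, by omega⟩))
    have hadm : IsEmpty (admissibleOfParity c d) := by
      refine ⟨fun k => huv ?_⟩
      obtain ⟨-, Q, a, b, -, hg, -, hpc⟩ := k.2
      exact coprime_gcd_of_modEq hg.2 (Int.natCast_modEq_iff.1 (hpc ⟨0, by omega⟩))
        (Int.natCast_modEq_iff.1 (hpc ⟨1, by omega⟩))
    have h := tendsto_fareyProportion (r := r) (by omega) c d (A := 0) (by simp [hgen])
    simpa using h
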